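/- All graphs are finite and simple. A brace is a connected bipartite graph that is either the 4-cycle $C_4$, or has at least six vertices and has the property that every matching of size at most two is contained in a perfect matching. A drawing of a graph in the plane represents the vertices by distinct points and every edge $uv$ by a simple arc joining the points of $u$ and $v$, such that no arc contains the point of a vertex that is not one of its ends, and the arcs of two different edges meet only in points of vertices. Its faces are the connected components (including the unbounded one) of the complement of the drawn graph, and a cycle bounds a face if the frontier of the face is exactly the drawing of the cycle. A graph is planar if it has a drawing in the plane. Lemma. Let $B$ be a planar brace not isomorphic to $C_4$. Then, in every drawing of $B$ in the plane, at least six distinct 4-cycles of $B$ each bound a face. The bound is attained by the cube: the graph of the 3-dimensional cube is a planar brace not isomorphic to $C_4$, and in every drawing of it in the plane exactly six 4-cycles bound a face. -/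

import Mathlib

open SimpleGraph

/-- Every matching of `G` with at most `k` edges (the empty one included) is contained in a
perfect matching of `G`. -/
def MatchingsExtend {V : Type*} (G : SimpleGraph V) (k : ℕ) : Prop :=
  ∀ M : G.Subgraph, M.IsMatching → M.edgeSet.encard ≤ k →
    ∃ P : G.Subgraph, P.IsPerfectMatching ∧ M ≤ P

/-- A (finite) brace: a connected bipartite graph that is either the 4-cycle, or has at least six
vertices and is such that every matching of size at most two extends to a perfect matching. -/
structure IsBrace {V : Type*} (G : SimpleGraph V) : Prop where
  connected : G.Connected
  bipartite : G.IsBipartite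
  extendable : Nonempty (G ≃g cycleGraph 4) ∨ (6 ≤ Nat.card V ∧ MatchingsExtend G 2)

/-- `A` is a simple arc in the plane with endpoints `a` and `b`. -/
def IsArc (A : Set ℂ) (a b : ℂ) : Prop :=
  ∃ γ : Path a b, Function.Injective γ ∧ Set.range γ = A

/-- A drawing of `G` in the plane (as a topological space, `ℂ` is the plane) without crossings.
Vertices are distinct points and each edge `uv` is a simple arc joining the points of `u` and `v`.
The only vertices on the arc of an edge are its ends, and the arcs of two different edges meet in
vertices only. The values of `arc` outside the edge set of `G` play no role. -/
structure PlaneDrawing {V : Type*} (G : SimpleGraph V) where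
  point : V → ℂ
  arc : Sym2 V → Set ℂ
  point_injective : Function.Injective point
  isArc : ∀ u v : V, G.Adj u v → IsArc (arc s(u, v)) (point u) (point v)
  mem_of_point_mem : ∀ e ∈ G.edgeSet, ∀ w : V, point w ∈ arc e → w ∈ e
  inter_subset : ∀ e ∈ G.edgeSet, ∀ e' ∈ G.edgeSet, e ≠ e' → arc e ∩ arc e' ⊆ Set.range point

/-- The point set of a subgraph `H` in a drawing: the points of its vertices together with the
arcs of its edges. -/
def PlaneDrawing.carrier {V : Type*} {G : SimpleGraph V} (D : PlaneDrawing G) (H : G.Subgraph) :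
    Set ℂ :=
  D.point '' H.verts ∪ ⋃ e ∈ H.edgeSet, D.arc e

/-- The faces of a drawing are the connected components of the complement of the drawn graph
(the unbounded one included). -/
def PlaneDrawing.IsFace {V : Type*} {G : SimpleGraph V} (D : PlaneDrawing G) (F : Set ℂ) : Prop :=
  ∃ x ∈ (D.carrier ⊤)ᶜ, F = connectedComponentIn (D.carrier ⊤)ᶜ x

/-- The subgraph `C` is a cycle of length four. -/
def IsFourCycle {V : Type*} {G : SimpleGraph V} (C : G.Subgraph) : Prop :=
  ∃ (v : V) (w : G.Walk v v), w.IsCycle ∧ w.length = 4 ∧ w.toSubgraph = C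

/-- The 4-cycles of `G` (as subgraphs) that bound a face of the drawing `D`. -/
def PlaneDrawing.facialFourCycles {V : Type*} {G : SimpleGraph V} (D : PlaneDrawing G) :
    Set G.Subgraph :=
  {C | IsFourCycle C ∧ ∃ F : Set ℂ, D.IsFace F ∧ frontier F = D.carrier C}

/-- The graph of the 3-dimensional cube: binary words of length three, adjacent when they differ
in exactly one position. -/
def cubeGraph : SimpleGraph (Fin 3 → Bool) where
  Adj x y := hammingDist x y = 1
  symm := ⟨fun x y h => by rw [hammingDist_comm]; exact h⟩
  loopless := ⟨fun x h => by simp at h⟩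

/-!
A graph of minimum degree three with `n` vertices and `m` edges has `3n ≤ 2m`. If it is bipartite,
bridgeless and drawn in the plane with `f` faces, then `f ≥ m - n + 2` by Euler's formula, each
edge borders two faces, and a face whose boundary is not a 4-cycle has at least six edges. With `a`
faces bounded by 4-cycles this gives `2m ≥ 4a + 6(f - a)`, hence `2a ≥ 6f - 2m ≥ 4m - 6n + 12 ≥ 12`
(`six_le_encard_facialFourCycles`). A brace other than `C₄` has these properties because a vertex of
degree two, or a bridge, would obstruct the extension of some matching of at most two edges
(`three_le_degree_of_matchingsExtend`, `reachable_deleteEdges_of_matchingsExtend`). Distinct faces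
are bounded by distinct 4-cycles since a closed curve of four edges and a vertex off it leave room
for only one other complementary component (`IsFace.eq_of_frontier_eq_four_cycle`).

Edges are arbitrary arcs, so the plane topology behind this is proved from scratch. Its tool is the
existence of continuous logarithms. If two points lie in the same component of the complement of a
set, then `(x - z) / (x - w)` has a logarithm on that set, by homotopy lifting for the covering
`exp` (`hasLogOn_of_joinedIn`); conversely, if it has one on a compact set, then that set does not
separate `z` from `w` (`connectedComponentIn_eq_of_hasLogOn`, Eilenberg's criterion). Every nowhere
vanishing function has a logarithm on an arc, and logarithms on two sets can be glued if the sets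
meet in a connected set. Three facts about an arc attached at both ends to a compact set follow: it
splits the component it runs through (`IsArc.exists_ne_of_attach`), into at most two components
(`IsArc.not_three_components`), and a component that touches its interior has all of it on the
frontier (`IsArc.subset_closure_component`). For drawings these yield the inequality in Euler's
formula, by deleting edges that are not bridges, and the description of the frontier of a face as a
union of edges without dead ends; in a bipartite graph such an edge set is a 4-cycle or has at least
six edges (`six_le_ncard_or_eq_four_cycle`).

For the cube the bound is sharp because every 4-cycle of the cube is one of the six obvious ones
(`Cube.exists_eq_faceCycle`).
-/

/-! ### Continuous logarithms -/

/-- `f` has a continuous logarithm on `S`. -/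
def HasLogOn (f : ℂ → ℂ) (S : Set ℂ) : Prop :=
  ∃ l : ℂ → ℂ, ContinuousOn l S ∧ ∀ z ∈ S, Complex.exp (l z) = f z

theorem HasLogOn.mono {f : ℂ → ℂ} {S T : Set ℂ} (h : HasLogOn f T) (hST : S ⊆ T) :
    HasLogOn f S := by
  obtain ⟨l, hl, he⟩ := h
  exact ⟨l, hl.mono hST, fun z hz => he z (hST hz)⟩

theorem HasLogOn.congr {f g : ℂ → ℂ} {S : Set ℂ} (h : HasLogOn f S) (hfg : S.EqOn f g) :
    HasLogOn g S := by
  obtain ⟨l, hl, he⟩ := h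
  exact ⟨l, hl, fun z hz => (he z hz).trans (hfg hz)⟩

theorem HasLogOn.mul {f g : ℂ → ℂ} {S : Set ℂ} (hf : HasLogOn f S) (hg : HasLogOn g S) :
    HasLogOn (fun z => f z * g z) S := by
  obtain ⟨l, hl, he⟩ := hf
  obtain ⟨m, hm, hme⟩ := hg
  exact ⟨fun z => l z + m z, hl.add hm, fun z hz => by rw [Complex.exp_add, he z hz, hme z hz]⟩

theorem HasLogOn.of_restrict {f : ℂ → ℂ} {S : Set ℂ} (l : C(S, ℂ))
    (h : ∀ z : S, Complex.exp (l z) = f z) : HasLogOn f S := by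
  classical
  refine ⟨fun z => if hz : z ∈ S then l ⟨z, hz⟩ else 0, ?_, fun z hz => ?_⟩
  · rw [continuousOn_iff_continuous_domRestrict]
    convert l.continuous using 1
    ext z
    simp
  · simpa [hz] using h ⟨z, hz⟩

/-- Homotopy lifting for the covering map `exp`: a continuous logarithm can be carried along a
homotopy of nowhere vanishing functions. -/
theorem exists_log_of_homotopy {X : Type*} [TopologicalSpace X] (H : unitInterval × X → ℂ)
    (hc : Continuous H) (h0 : ∀ x, H x ≠ 0) (l : C(X, ℂ))
    (hl : ∀ x, Complex.exp (l x) = H (0, x)) :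
    ∃ m : C(X, ℂ), ∀ x, Complex.exp (m x) = H (1, x) := by
  let H' : C(unitInterval × X, {z : ℂ // z ≠ 0}) := ⟨fun x => ⟨H x, h0 x⟩, by fun_prop⟩
  have hH' : ∀ x, H' (0, x) = ⟨Complex.exp (l x), Complex.exp_ne_zero _⟩ := fun x =>
    Subtype.ext (hl x).symm
  have key := Complex.isCoveringMap_exp.liftHomotopy_lifts H' l hH'
  refine ⟨(Complex.isCoveringMap_exp.liftHomotopy H' l hH').comp
    ⟨fun x => (1, x), by fun_prop⟩, fun x => ?_⟩
  exact congrArg Subtype.val (congrFun key (1, x))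

/-- Two logarithms of the same function differ by a constant on a preconnected set. -/
theorem exists_eqOn_add_of_exp_eq {S : Set ℂ} (hS : IsPreconnected S) {l m : ℂ → ℂ}
    (hl : ContinuousOn l S) (hm : ContinuousOn m S)
    (h : ∀ z ∈ S, Complex.exp (l z) = Complex.exp (m z)) :
    ∃ c, Complex.exp c = 1 ∧ ∀ z ∈ S, l z = m z + c := by
  rcases S.eq_empty_or_nonempty with rfl | ⟨a, ha⟩
  · exact ⟨0, by simp, by simp⟩
  have hc : Complex.exp (l a - m a) = 1 := by
    rw [Complex.exp_sub, h a ha, div_self (Complex.exp_ne_zero _)]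
  refine ⟨l a - m a, hc, ?_⟩
  refine Complex.isCoveringMap_exp.eqOn_of_comp_eqOn hS hl (hm.add continuousOn_const) ?_ ha
    (by ring)
  intro z hz
  refine Subtype.ext ?_
  change Complex.exp _ = Complex.exp _
  rw [Complex.exp_add, hc, mul_one, h z hz]

theorem exists_eqOn_of_eqOn_inter {l m : ℂ → ℂ} {S T : Set ℂ} (h : ∀ z ∈ S ∩ T, l z = m z) :
    ∃ k : ℂ → ℂ, S.EqOn k l ∧ T.EqOn k m := by
  classical
  refine ⟨S.piecewise l m, Set.piecewise_eqOn _ _ _, fun z hz => ?_⟩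
  by_cases hzS : z ∈ S
  · simpa [hzS] using h z ⟨hzS, hz⟩
  · simp [hzS]

theorem HasLogOn.union_of_isOpen {f : ℂ → ℂ} {S T : Set ℂ} (hS : IsOpen S) (hT : IsOpen T)
    (hST : IsPreconnected (S ∩ T)) (h : HasLogOn f S) (h' : HasLogOn f T) :
    HasLogOn f (S ∪ T) := by
  obtain ⟨l, hl, hle⟩ := h
  obtain ⟨m, hm, hme⟩ := h'
  obtain ⟨c, hc, hlm⟩ := exists_eqOn_add_of_exp_eq hST (hl.mono Set.inter_subset_left)
    (hm.mono Set.inter_subset_right) (fun z hz => (hle z hz.1).trans (hme z hz.2).symm)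
  obtain ⟨k, hkl, hkm⟩ := exists_eqOn_of_eqOn_inter (m := fun z => m z + c) hlm
  refine ⟨k, (hl.congr hkl).union_of_isOpen ((hm.add continuousOn_const).congr hkm) hS hT, ?_⟩
  rintro z (hz | hz)
  · rw [hkl hz, hle z hz]
  · rw [hkm hz, Complex.exp_add, hc, mul_one, hme z hz]

theorem HasLogOn.union_of_isClosed {f : ℂ → ℂ} {S T : Set ℂ} (hS : IsClosed S) (hT : IsClosed T)
    (hST : (S ∩ T).Subsingleton) (h : HasLogOn f S) (h' : HasLogOn f T) :
    HasLogOn f (S ∪ T) := by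
  obtain ⟨l, hl, hle⟩ := h
  obtain ⟨m, hm, hme⟩ := h'
  obtain ⟨c, hc, hlm⟩ := exists_eqOn_add_of_exp_eq hST.isPreconnected
    (hl.mono Set.inter_subset_left) (hm.mono Set.inter_subset_right)
    (fun z hz => (hle z hz.1).trans (hme z hz.2).symm)
  obtain ⟨k, hkl, hkm⟩ := exists_eqOn_of_eqOn_inter (m := fun z => m z + c) hlm
  refine ⟨k, (hl.congr hkl).union_of_isClosed ((hm.add continuousOn_const).congr hkm) hS hT, ?_⟩
  rintro z (hz | hz)
  · rw [hkl hz, hle z hz]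
  · rw [hkm hz, Complex.exp_add, hc, mul_one, hme z hz]

/-- If a path from `a` to `b` avoids `S`, then `(z - a) / (z - b)` has a logarithm on `S`: move `b`
along the path to `a`. -/
theorem hasLogOn_of_joinedIn {S : Set ℂ} {a b : ℂ} (h : JoinedIn Sᶜ a b) :
    HasLogOn (fun z => (z - a) / (z - b)) S := by
  obtain ⟨γ, hγ⟩ := h.symm
  have hb : ∀ z : S, (z : ℂ) - b ≠ 0 := fun z hz =>
    h.target_mem (by rw [← sub_eq_zero.1 hz]; exact z.2)
  have hγ' : ∀ (t) (z : S), (z : ℂ) - γ t ≠ 0 := fun t z hz =>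
    hγ t (by rw [← sub_eq_zero.1 hz]; exact z.2)
  obtain ⟨m, hm⟩ := exists_log_of_homotopy (X := S) (fun x => ((x.2 : ℂ) - γ x.1) / (x.2 - b))
    (Continuous.div (by fun_prop) (by fun_prop) fun x => hb _)
    (fun x => div_ne_zero (hγ' _ _) (hb _)) (ContinuousMap.const _ 0)
    (fun x => by simp [div_self (hb x)])
  exact HasLogOn.of_restrict m fun z => by simpa using hm z

/-- No branch of `log (c * (z - a) ^ n)`, `n ≠ 0`, exists on a circle around `a`. -/
theorem not_hasLogOn_sphere {a c : ℂ} {r : ℝ} (hr : 0 < r) (hc : c ≠ 0) {n : ℤ} (hn : n ≠ 0) :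
    ¬ HasLogOn (fun z => c * (z - a) ^ n) (Metric.sphere a r) := by
  rintro ⟨l, hl, hle⟩
  have hmem : ∀ θ : ℝ, circleMap a r θ ∈ Metric.sphere a r := fun θ =>
    circleMap_mem_sphere a hr.le θ
  have hr' : (r : ℂ) ^ n ≠ 0 := zpow_ne_zero _ (by exact_mod_cast hr.ne')
  -- after subtracting `n * θ * I` the logarithm becomes constant along the circle
  have hg : Continuous fun θ : ℝ => l (circleMap a r θ) :=
    hl.comp_continuous (continuous_circleMap a r) hmem
  have hre : IsPreconnected (Complex.re ⁻¹' Set.univ ∩ Complex.im ⁻¹' {0}) := by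
    have : IsPreconnected (Set.range ((↑) : ℝ → ℂ)) :=
      isPreconnected_range Complex.continuous_ofReal
    convert this using 1
    ext z
    simp only [Set.preimage_univ, Set.univ_inter, Set.mem_preimage, Set.mem_singleton_iff,
      Set.mem_range]
    exact ⟨fun h => ⟨z.re, Complex.ext (by simp) (by simp [h])⟩, by rintro ⟨y, rfl⟩; simp⟩
  obtain ⟨d, -, hd⟩ := exists_eqOn_add_of_exp_eq hre
    (l := fun z => l (circleMap a r z.re))
    (m := fun z => Complex.log (c * r ^ n) + n * (z.re * Complex.I))
    (hg.comp Complex.continuous_re).continuousOn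
    (by fun_prop) (fun z _ => by
      rw [hle _ (hmem _), Complex.exp_add, Complex.exp_log (mul_ne_zero hc hr'),
        Complex.exp_int_mul, circleMap]
      simp [mul_zpow]
      ring)
  have h0 := hd 0 (by simp)
  have h1 := hd ((2 * Real.pi : ℝ) : ℂ) (by simp)
  have hper : circleMap a r (2 * Real.pi) = circleMap a r 0 := by simp [circleMap]
  simp only [Complex.zero_re, Complex.ofReal_re, hper] at h0 h1
  rw [h0] at h1
  simp [hn, Real.pi_ne_zero] at h1

/-! ### Separation of points by compact sets -/

/-- A nowhere vanishing continuous function on the plane has a logarithm. -/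
theorem hasLogOn_univ {G : ℂ → ℂ} (hG : Continuous G) (h0 : ∀ z, G z ≠ 0) :
    HasLogOn G Set.univ := by
  obtain ⟨m, hm⟩ := exists_log_of_homotopy (X := ℂ) (fun x => G (((x.1 : ℝ) : ℂ) * x.2))
    (by fun_prop) (fun x => h0 _) (ContinuousMap.const _ (Complex.log (G 0)))
    (fun x => by simp [Complex.exp_log (h0 0)])
  exact ⟨m, m.continuous.continuousOn, fun z _ => by simpa using hm z⟩

/-- Eilenberg's criterion. The frontier of a bounded open set `W` carries no logarithm of
`(z - p) ^ n * u z` if `p ∈ W`, `n ≠ 0` and `u` has no zeros in `closure W`. -/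
theorem not_hasLogOn_frontier {W : Set ℂ} (hW : IsOpen W) (hb : Bornology.IsBounded W) {p : ℂ}
    (hp : p ∈ W) {n : ℤ} (hn : n ≠ 0) {u : ℂ → ℂ} (hu : ContinuousOn u (closure W))
    (hu0 : ∀ z ∈ closure W, u z ≠ 0) :
    ¬ HasLogOn (fun z => (z - p) ^ n * u z) (frontier W) := by
  classical
  rintro ⟨l, hl, hle⟩
  obtain ⟨L, hL⟩ := ContinuousMap.exists_restrict_eq isClosed_frontier
    ⟨(frontier W).domRestrict l, continuousOn_iff_continuous_domRestrict.1 hl⟩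
  have hL' : ∀ z ∈ frontier W, L z = l z := fun z hz => congrArg (fun f => f ⟨z, hz⟩) hL
  -- replace `(z - p) ^ n` inside `W` by a function without zeros
  let G : ℂ → ℂ := fun z => if z ∈ closure W then Complex.exp (L z) / u z else (z - p) ^ n
  have hpc : ∀ z ∈ closure {z | z ∉ closure W}, z - p ≠ 0 := by
    intro z hz h
    have hz' : z ∈ W := by rwa [sub_eq_zero.1 h]
    obtain ⟨y, hy, hy'⟩ := mem_closure_iff.1 hz W hW hz'
    exact hy' (subset_closure hy)
  have hG : Continuous G := by
    refine continuous_if (fun z hz => ?_) ?_ ?_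
    · have hz' : z ∈ frontier W := frontier_closure_subset hz
      rw [hL' z hz', hle z hz', mul_div_assoc, div_self (hu0 z hz'.1), mul_one]
    · simp only [Set.ofPred_mem_eq, closure_closure]
      exact (by fun_prop : Continuous fun z => Complex.exp (L z)).continuousOn.div hu hu0
    · exact ContinuousOn.zpow₀ (by fun_prop) n fun z hz => Or.inl (hpc z hz)
  have hG0 : ∀ z, G z ≠ 0 := by
    intro z
    by_cases hz : z ∈ closure W
    · simp only [G, hz, if_true]
      exact div_ne_zero (Complex.exp_ne_zero _) (hu0 z hz)
    · simp only [G, hz, if_false]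
      exact zpow_ne_zero _ (hpc z (subset_closure hz))
  obtain ⟨R, hR0, hR⟩ := hb.closure.subset_ball_lt 0 p
  refine not_hasLogOn_sphere hR0 one_ne_zero hn
    (((hasLogOn_univ hG hG0).mono (Set.subset_univ (Metric.sphere p R))).congr fun z hz => ?_)
  have hz' : z ∉ closure W := fun h => by
    have h1 := hR h
    rw [Metric.mem_ball, Metric.mem_sphere.1 hz] at h1
    exact lt_irrefl _ h1
  simp [G, hz']

theorem frontier_component_subset {K F : Set ℂ} {x : ℂ} (hK : IsClosed K)
    (hF : F = connectedComponentIn Kᶜ x) : frontier F ⊆ K := by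
  subst hF
  intro y hy
  by_contra hyK
  have hop : IsOpen (connectedComponentIn Kᶜ y) := hK.isOpen_compl.connectedComponentIn
  obtain ⟨w, hw, hw'⟩ := mem_closure_iff.1 hy.1 _ hop (mem_connectedComponentIn hyK)
  have h1 := connectedComponentIn_eq hw
  have h2 := connectedComponentIn_eq hw'
  have : y ∈ connectedComponentIn Kᶜ x := by
    rw [h2, ← h1]; exact mem_connectedComponentIn hyK
  rw [frontier, (hK.isOpen_compl.connectedComponentIn).interior_eq] at hy
  exact hy.2 this

theorem isPreconnected_compl_closedBall (r : ℝ) :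
    IsPreconnected (Metric.closedBall (0 : ℂ) r)ᶜ := by
  rcases lt_or_ge r 0 with hr | hr
  · rw [Metric.closedBall_eq_empty.2 hr, Set.compl_empty]
    exact isPreconnected_univ
  -- the image of a half plane under `exp`
  have h : (Metric.closedBall (0 : ℂ) r)ᶜ =
      (fun z : ℂ => (r + Real.exp z.re) * Complex.exp (z.im * Complex.I)) '' Set.univ := by
    ext w
    simp only [Set.mem_compl_iff, Metric.mem_closedBall, dist_zero_right, not_le, Set.image_univ,
      Set.mem_range]
    constructor
    · intro hw
      refine ⟨⟨Real.log (‖w‖ - r), w.arg⟩, ?_⟩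
      simp only [Real.exp_log (sub_pos.2 hw)]
      push_cast
      rw [add_sub_cancel, Complex.norm_mul_exp_arg_mul_I]
    · rintro ⟨z, rfl⟩
      rw [norm_mul, Complex.norm_exp_ofReal_mul_I, mul_one]
      norm_cast
      rw [Real.norm_of_nonneg (by positivity)]
      linarith [Real.exp_pos z.re]
  rw [h]
  exact isPreconnected_univ.image _ (by fun_prop)

/-- The complement of a compact set has at most one unbounded component. -/
theorem isBounded_or_isBounded_of_ne {K : Set ℂ} (hK : IsCompact K) {z w : ℂ}
    (h : connectedComponentIn Kᶜ z ≠ connectedComponentIn Kᶜ w) :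
    Bornology.IsBounded (connectedComponentIn Kᶜ z) ∨
      Bornology.IsBounded (connectedComponentIn Kᶜ w) := by
  by_contra! hcon
  obtain ⟨R, hR⟩ := hK.isBounded.subset_closedBall 0
  have key : ∀ x, ¬ Bornology.IsBounded (connectedComponentIn Kᶜ x) →
      (Metric.closedBall (0 : ℂ) R)ᶜ ⊆ connectedComponentIn Kᶜ x := by
    intro x hx
    obtain ⟨y, hy, hyR⟩ : ∃ y ∈ connectedComponentIn Kᶜ x, y ∉ Metric.closedBall (0 : ℂ) R := by
      by_contra! hall
      exact hx (Metric.isBounded_closedBall.subset hall)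
    rw [connectedComponentIn_eq hy]
    exact (isPreconnected_compl_closedBall R).subset_connectedComponentIn hyR
      (Set.compl_subset_compl.2 hR)
  have hy : ((|R| + 1 : ℝ) : ℂ) ∈ (Metric.closedBall (0 : ℂ) R)ᶜ := by
    simp only [Set.mem_compl_iff, Metric.mem_closedBall, dist_zero_right, Complex.norm_real]
    rw [Real.norm_of_nonneg (by positivity)]
    linarith [le_abs_self R]
  exact h ((connectedComponentIn_eq (key z hcon.1 hy)).trans
    (connectedComponentIn_eq (key w hcon.2 hy)).symm)

theorem sub_ne_zero_of_mem_closure_component {K : Set ℂ} {z w x : ℂ}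
    (hx : x ∈ closure (connectedComponentIn Kᶜ z)) (hK : IsClosed K) (hw : w ∈ Kᶜ)
    (h : connectedComponentIn Kᶜ z ≠ connectedComponentIn Kᶜ w) : x - w ≠ 0 := by
  intro h0
  rw [sub_eq_zero.1 h0] at hx
  have hop : IsOpen (connectedComponentIn Kᶜ w) := hK.isOpen_compl.connectedComponentIn
  obtain ⟨v, hv, hv'⟩ := mem_closure_iff.1 hx _ hop (mem_connectedComponentIn hw)
  exact h ((connectedComponentIn_eq hv').trans (connectedComponentIn_eq hv).symm)

/-- A compact set on which `(x - z) / (x - w)` has a logarithm does not separate `z` from `w`. -/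
theorem connectedComponentIn_eq_of_hasLogOn {K : Set ℂ} (hK : IsCompact K) {z w : ℂ}
    (hz : z ∈ Kᶜ) (hw : w ∈ Kᶜ) (h : HasLogOn (fun x => (x - z) / (x - w)) K) :
    connectedComponentIn Kᶜ z = connectedComponentIn Kᶜ w := by
  by_contra hne
  have hop : ∀ x, IsOpen (connectedComponentIn Kᶜ x) := fun x =>
    hK.isClosed.isOpen_compl.connectedComponentIn
  have hfr : ∀ x, frontier (connectedComponentIn Kᶜ x) ⊆ K := fun x =>
    frontier_component_subset hK.isClosed rfl
  rcases isBounded_or_isBounded_of_ne hK hne with hb | hb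
  · refine not_hasLogOn_frontier (hop z) hb (mem_connectedComponentIn hz) one_ne_zero
      (u := fun x => (x - w)⁻¹) (ContinuousOn.inv₀ (by fun_prop) fun x hx => ?_) (fun x hx => ?_)
      ((h.mono (hfr z)).congr fun x _ => by simp [div_eq_mul_inv])
    · exact sub_ne_zero_of_mem_closure_component hx hK.isClosed hw hne
    · exact inv_ne_zero (sub_ne_zero_of_mem_closure_component hx hK.isClosed hw hne)
  · refine not_hasLogOn_frontier (hop w) hb (mem_connectedComponentIn hw)
      (show (-1 : ℤ) ≠ 0 by decide)
      (u := fun x => x - z) (by fun_prop) (fun x hx => ?_)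
      ((h.mono (hfr w)).congr fun x _ => by simp [div_eq_mul_inv, mul_comm])
    exact sub_ne_zero_of_mem_closure_component hx hK.isClosed hz (Ne.symm hne)

/-! ### Arcs -/

theorem IsArc.symm {A : Set ℂ} {a b : ℂ} (h : IsArc A a b) : IsArc A b a := by
  obtain ⟨γ, hγ, rfl⟩ := h
  exact ⟨γ.symm, hγ.comp unitInterval.symm_bijective.injective, γ.symm_range⟩

theorem IsArc.isCompact {A : Set ℂ} {a b : ℂ} (h : IsArc A a b) : IsCompact A := by
  obtain ⟨γ, -, rfl⟩ := h
  exact isCompact_range γ.continuous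

theorem IsArc.ne {A : Set ℂ} {a b : ℂ} (h : IsArc A a b) : a ≠ b := by
  obtain ⟨γ, hγ, rfl⟩ := h
  intro hab
  have : γ 0 = γ 1 := by rw [γ.source, γ.target, hab]
  exact zero_ne_one (hγ this)

theorem IsArc.left_mem {A : Set ℂ} {a b : ℂ} (h : IsArc A a b) : a ∈ A := by
  obtain ⟨γ, -, rfl⟩ := h
  exact ⟨0, γ.source⟩

theorem IsArc.right_mem {A : Set ℂ} {a b : ℂ} (h : IsArc A a b) : b ∈ A := h.symm.left_mem

theorem Path.range_diff_endpoints {a b : ℂ} {γ : Path a b} (hγ : Function.Injective γ) :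
    Set.range γ \ {a, b} = γ '' Set.Ioo 0 1 := by
  ext z
  constructor
  · rintro ⟨⟨t, rfl⟩, ht⟩
    refine ⟨t, ⟨bot_lt_iff_ne_bot.2 ?_, lt_top_iff_ne_top.2 ?_⟩, rfl⟩
    · rintro rfl; exact ht (Or.inl γ.source)
    · rintro rfl; exact ht (Or.inr γ.target)
  · rintro ⟨t, ⟨h0, h1⟩, rfl⟩
    refine ⟨⟨t, rfl⟩, ?_⟩
    rintro (h | h)
    · exact h0.ne' (hγ (h.trans γ.source.symm))
    · exact h1.ne (hγ (h.trans γ.target.symm))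

theorem IsArc.isPreconnected_diff {A : Set ℂ} {a b : ℂ} (h : IsArc A a b) :
    IsPreconnected (A \ {a, b}) := by
  obtain ⟨γ, hγ, rfl⟩ := h
  rw [Path.range_diff_endpoints hγ]
  exact isPreconnected_Ioo.image _ γ.continuous.continuousOn

theorem IsArc.nonempty_diff {A : Set ℂ} {a b : ℂ} (h : IsArc A a b) : (A \ {a, b}).Nonempty := by
  obtain ⟨γ, hγ, rfl⟩ := h
  rw [Path.range_diff_endpoints hγ]
  exact (Set.nonempty_Ioo.2 zero_lt_one).image _

theorem IsArc.subset_closure_diff {A : Set ℂ} {a b : ℂ} (h : IsArc A a b) :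
    A ⊆ closure (A \ {a, b}) := by
  obtain ⟨γ, hγ, rfl⟩ := h
  rw [Path.range_diff_endpoints hγ]
  rintro _ ⟨t, rfl⟩
  refine image_closure_subset_closure_image γ.continuous ⟨t, ?_, rfl⟩
  rw [closure_Ioo zero_ne_one]
  exact ⟨t.2.1, t.2.2⟩

theorem isPreconnected_ball_diff_singleton (c : ℂ) (r : ℝ) :
    IsPreconnected (Metric.ball c r \ {c}) := by
  have h : Metric.ball c r \ {c} =
      (fun x : ℝ × ℝ => circleMap c x.1 x.2) '' (Set.Ioo 0 r ×ˢ Set.univ) := by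
    ext z
    simp only [Set.mem_sdiff, Metric.mem_ball, Set.mem_singleton_iff, Set.mem_image, Set.mem_prod,
      Set.mem_Ioo, Set.mem_univ, and_true, Prod.exists, dist_eq_norm]
    constructor
    · rintro ⟨h1, h2⟩
      refine ⟨‖z - c‖, (z - c).arg, ⟨norm_pos_iff.2 (sub_ne_zero.2 h2), h1⟩, ?_⟩
      rw [circleMap, Complex.norm_mul_exp_arg_mul_I, add_sub_cancel]
    · rintro ⟨s, θ, ⟨hs, hsr⟩, rfl⟩
      simp [circleMap, abs_of_pos hs, hsr, hs.ne']
  rw [h]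
  refine (isPreconnected_Ioo.prod isPreconnected_univ).image _ (Continuous.continuousOn ?_)
  unfold circleMap
  fun_prop

/-- Removing an interior point disconnects an arc, removing the centre does not disconnect a
disc. -/
theorem IsArc.interior_eq_empty {A : Set ℂ} {a b : ℂ} (h : IsArc A a b) : interior A = ∅ := by
  obtain ⟨γ, hγ, rfl⟩ := h
  by_contra hne
  obtain ⟨c, hc⟩ := Set.nonempty_iff_ne_empty.2 hne
  have hdense : Dense (Set.Ioo (0 : unitInterval) 1) := by
    rw [dense_iff_closure_eq, closure_Ioo zero_ne_one]
    exact Set.eq_univ_of_forall fun t => ⟨t.2.1, t.2.2⟩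
  obtain ⟨t, ht, ht'⟩ := hdense.inter_open_nonempty _ (isOpen_interior.preimage γ.continuous) (by
    obtain ⟨t, rfl⟩ := interior_subset hc
    exact ⟨t, hc⟩)
  obtain ⟨r, hr, hball⟩ := Metric.isOpen_iff.1 isOpen_interior _ ht
  replace hball := hball.trans interior_subset
  let e : unitInterval ≃ₜ Set.range γ :=
    (γ.continuous.isClosedEmbedding hγ).isEmbedding.toHomeomorph
  have hpre : IsPreconnected (γ ⁻¹' (Metric.ball (γ t) r \ {γ t})) := by
    have h1 : IsPreconnected ((↑) ⁻¹' (Metric.ball (γ t) r \ {γ t}) : Set (Set.range γ)) := by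
      rw [← Topology.IsInducing.subtypeVal.isPreconnected_image, Subtype.image_preimage_coe,
        Set.inter_eq_right.2 (Set.sdiff_subset.trans hball)]
      exact isPreconnected_ball_diff_singleton _ _
    exact e.isPreconnected_preimage.2 h1
  have hnhds : γ ⁻¹' Metric.ball (γ t) r ∈ nhds t :=
    (Metric.isOpen_ball.preimage γ.continuous).mem_nhds (Metric.mem_ball_self hr)
  obtain ⟨s, u, ⟨hst, htu⟩, hsu⟩ :=
    (mem_nhds_iff_exists_Ioo_subset' ⟨0, ht'.1⟩ ⟨1, ht'.2⟩).1 hnhds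
  obtain ⟨s', hs, hs'⟩ := exists_between hst
  obtain ⟨u', hu, hu'⟩ := exists_between htu
  have h1 := hpre.ordConnected.out
    (x := s') ⟨hsu ⟨hs, hs'.trans htu⟩, fun h => hs'.ne (hγ h)⟩
    (y := u') ⟨hsu ⟨hst.trans hu, hu'⟩, fun h => hu.ne' (hγ h)⟩ ⟨hs'.le, hu.le⟩
  exact h1.2 rfl

theorem hasLogOn_image_Iic {a b : ℂ} {γ : Path a b} (hγ : Function.Injective γ)
    (s : unitInterval) {f : ℂ → ℂ} (hf : ContinuousOn f (γ '' Set.Iic s))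
    (h0 : ∀ z ∈ γ '' Set.Iic s, f z ≠ 0) : HasLogOn f (γ '' Set.Iic s) := by
  let e : unitInterval ≃ₜ Set.range γ :=
    (γ.continuous.isClosedEmbedding hγ).isEmbedding.toHomeomorph
  have he : ∀ (x : ℂ) (hx : x ∈ Set.range γ), γ (e.symm ⟨x, hx⟩) = x := fun x hx =>
    congrArg Subtype.val (e.apply_symm_apply ⟨x, hx⟩)
  have hsub : ∀ x : (γ '' Set.Iic s : Set ℂ), (x : ℂ) ∈ Set.range γ := fun x =>
    Set.image_subset_range _ _ x.2
  have hle : ∀ x : (γ '' Set.Iic s : Set ℂ), e.symm ⟨x, hsub x⟩ ≤ s := by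
    intro x
    obtain ⟨t, ht, hx⟩ := x.2
    have h1 : e.symm ⟨x, hsub x⟩ = t := hγ ((he _ _).trans hx.symm)
    rw [h1]
    exact ht
  have hmem : ∀ y : unitInterval × (γ '' Set.Iic s : Set ℂ),
      γ (y.1 * e.symm ⟨y.2, hsub y.2⟩) ∈ γ '' Set.Iic s := fun y =>
    ⟨_, (unitInterval.mul_le_right).trans (hle y.2), rfl⟩
  obtain ⟨m, hm⟩ := exists_log_of_homotopy (X := (γ '' Set.Iic s : Set ℂ))
    (fun y => f (γ (y.1 * e.symm ⟨y.2, hsub y.2⟩)))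
    (hf.comp_continuous (by fun_prop) hmem) (fun y => h0 _ (hmem y))
    (ContinuousMap.const _ (Complex.log (f a)))
    (fun x => by
      have ha := h0 a ⟨0, s.2.1, γ.source⟩
      simp [Complex.exp_log ha])
  refine HasLogOn.of_restrict m fun z => ?_
  rw [hm z]
  simp [he]

theorem IsArc.hasLogOn {A : Set ℂ} {a b : ℂ} (h : IsArc A a b) {f : ℂ → ℂ}
    (hf : ContinuousOn f A) (h0 : ∀ z ∈ A, f z ≠ 0) : HasLogOn f A := by
  obtain ⟨γ, hγ, rfl⟩ := h
  have : Set.range γ = γ '' Set.Iic 1 := by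
    rw [← Set.image_univ]
    congr 1
    exact (Set.eq_univ_of_forall fun t => t.2.2).symm
  rw [this] at hf h0 ⊢
  exact hasLogOn_image_Iic hγ 1 hf h0

theorem IsArc.hasLogOn_compl {A : Set ℂ} {a b : ℂ} (h : IsArc A a b) :
    HasLogOn (fun z => (z - a) / (z - b)) Aᶜ := by
  obtain ⟨γ, -, rfl⟩ := h
  exact hasLogOn_of_joinedIn ⟨γ, fun t => by simp⟩

theorem joinedIn_of_connectedComponentIn_eq {U : Set ℂ} (hU : IsOpen U) {z w : ℂ} (hz : z ∈ U)
    (hw : w ∈ U) (h : connectedComponentIn U z = connectedComponentIn U w) : JoinedIn U z w := by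
  have h1 : IsPathConnected (connectedComponentIn U z) :=
    hU.connectedComponentIn.isConnected_iff_isPathConnected.1
      (isConnected_connectedComponentIn_iff.2 hz)
  exact (h1.joinedIn z (mem_connectedComponentIn hz) w
    (h ▸ mem_connectedComponentIn hw)).mono (connectedComponentIn_subset _ _)

theorem continuousOn_div_sub {S : Set ℂ} {z w : ℂ} (hw : w ∉ S) :
    ContinuousOn (fun x => (x - z) / (x - w)) S :=
  ContinuousOn.div (by fun_prop) (by fun_prop) fun x hx h => hw (by rwa [← sub_eq_zero.1 h])

theorem div_sub_ne_zero {S : Set ℂ} {z w x : ℂ} (hz : z ∉ S) (hw : w ∉ S) (hx : x ∈ S) :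
    (x - z) / (x - w) ≠ 0 :=
  div_ne_zero (fun h => hz (by rwa [← sub_eq_zero.1 h])) (fun h => hw (by rwa [← sub_eq_zero.1 h]))

theorem connectedComponentIn_eq_of_isPreconnected {U S : Set ℂ} (hS : IsPreconnected S)
    (hSU : S ⊆ U) {z w : ℂ} (hz : z ∈ S) (hw : w ∈ S) :
    connectedComponentIn U z = connectedComponentIn U w :=
  connectedComponentIn_eq (hS.subset_connectedComponentIn hz hSU hw)

/-! ### Attaching an arc to a compact set -/

/-- An arc attached at both ends to a compact set `K` splits the component of `Kᶜ` that
it runs through, provided its ends are connected through `K`, in the sense that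
`(z - a) / (z - b)` has a logarithm off `K`. -/
theorem IsArc.exists_ne_of_attach {K A : Set ℂ} {a b : ℂ} (hK : IsCompact K) (hA : IsArc A a b)
    (hKA : K ∩ A = {a, b}) (hlog : HasLogOn (fun z => (z - a) / (z - b)) Kᶜ) {q : ℂ}
    (hq : q ∈ A \ {a, b}) :
    ∃ y₁ ∈ (K ∪ A)ᶜ, ∃ y₂ ∈ (K ∪ A)ᶜ, connectedComponentIn Kᶜ y₁ = connectedComponentIn Kᶜ q ∧
      connectedComponentIn Kᶜ y₂ = connectedComponentIn Kᶜ q ∧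
      connectedComponentIn (K ∪ A)ᶜ y₁ ≠ connectedComponentIn (K ∪ A)ᶜ y₂ := by
  by_contra! hcon
  have hAK : A \ {a, b} ⊆ Kᶜ := fun x hx hxK => hx.2 (hKA ▸ ⟨hxK, hx.1⟩)
  have hsub : A \ {a, b} ⊆ connectedComponentIn Kᶜ q :=
    hA.isPreconnected_diff.subset_connectedComponentIn hq hAK
  have hmem : ∀ y ∈ Aᶜ ∩ connectedComponentIn Kᶜ q, y ∈ (K ∪ A)ᶜ ∧
      connectedComponentIn Kᶜ y = connectedComponentIn Kᶜ q := fun y hy =>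
    ⟨fun h => h.elim (connectedComponentIn_subset _ _ hy.2) hy.1,
      (connectedComponentIn_eq hy.2).symm⟩
  have hpre : IsPreconnected (Aᶜ ∩ connectedComponentIn Kᶜ q) := by
    rcases (Aᶜ ∩ connectedComponentIn Kᶜ q).eq_empty_or_nonempty with h | ⟨y, hy⟩
    · rw [h]; exact isPreconnected_empty
    · have : Aᶜ ∩ connectedComponentIn Kᶜ q = connectedComponentIn (K ∪ A)ᶜ y := by
        apply Set.Subset.antisymm
        · intro x hx
          rw [hcon y (hmem y hy).1 x (hmem x hx).1 (hmem y hy).2 (hmem x hx).2]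
          exact mem_connectedComponentIn (hmem x hx).1
        · refine Set.subset_inter (fun x hx hxA =>
            connectedComponentIn_subset _ _ hx (Or.inr hxA)) ?_
          rw [← (hmem y hy).2]
          exact connectedComponentIn_mono _ (Set.compl_subset_compl.2 Set.subset_union_left)
      rw [this]
      exact isPreconnected_connectedComponentIn
  have hU := HasLogOn.union_of_isOpen hA.isCompact.isClosed.isOpen_compl
    hK.isClosed.isOpen_compl.connectedComponentIn hpre hA.hasLogOn_compl
    (hlog.mono (connectedComponentIn_subset _ q))
  -- the logarithm now exists near `a`, which contradicts the winding of `z - a` around `a`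
  have hab : 0 < dist a b := dist_pos.2 hA.ne
  have hne : ∀ z ∈ closure (Metric.ball a (dist a b / 2)), z ≠ b := by
    rintro z hz rfl
    have := Metric.closure_ball_subset_closedBall hz
    rw [Metric.mem_closedBall, _root_.dist_comm] at this
    linarith
  refine not_hasLogOn_frontier Metric.isOpen_ball Metric.isBounded_ball
    (Metric.mem_ball_self (half_pos hab)) one_ne_zero (u := fun z => (z - b)⁻¹)
    (ContinuousOn.inv₀ (by fun_prop) fun z hz => sub_ne_zero.2 (hne z hz))
    (fun z hz => inv_ne_zero (sub_ne_zero.2 (hne z hz)))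
    ((hU.mono fun z hz => ?_).congr fun z _ => by simp [div_eq_mul_inv])
  by_cases hzA : z ∈ A
  · refine Or.inr (hsub ⟨hzA, ?_⟩)
    rintro (rfl | rfl)
    · rw [Metric.isOpen_ball.frontier_eq] at hz
      exact hz.2 (Metric.mem_ball_self (half_pos hab))
    · exact hne _ hz.1 rfl
  · exact Or.inl hzA

/-- An arc attached to a compact set `K` splits a component of `Kᶜ` into at most two parts: if
three points are not separated by `K`, then the arc does not separate all of them. -/
theorem IsArc.not_three_components {K A : Set ℂ} {a b : ℂ} (hK : IsCompact K) (hA : IsArc A a b)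
    (hKA : K ∩ A = {a, b}) {z₁ z₂ z₃ : ℂ} (h₁ : z₁ ∈ (K ∪ A)ᶜ) (h₂ : z₂ ∈ (K ∪ A)ᶜ)
    (h₃ : z₃ ∈ (K ∪ A)ᶜ) (hl₂ : HasLogOn (fun x => (x - z₁) / (x - z₂)) K)
    (hl₃ : HasLogOn (fun x => (x - z₁) / (x - z₃)) K)
    (h₁₂ : connectedComponentIn (K ∪ A)ᶜ z₁ ≠ connectedComponentIn (K ∪ A)ᶜ z₂)
    (h₁₃ : connectedComponentIn (K ∪ A)ᶜ z₁ ≠ connectedComponentIn (K ∪ A)ᶜ z₃)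
    (h₂₃ : connectedComponentIn (K ∪ A)ᶜ z₂ ≠ connectedComponentIn (K ∪ A)ᶜ z₃) : False := by
  have hKAc : IsCompact (K ∪ A) := hK.union hA.isCompact
  have haK : a ∈ K ∩ A := hKA ▸ Or.inl rfl
  have hbK : b ∈ K ∩ A := hKA ▸ Or.inr rfl
  have hnA : ∀ {z}, z ∈ (K ∪ A)ᶜ → z ∉ A := fun h h' => h (Or.inr h')
  -- the monodromy of each quotient around a loop through `K` and `A`
  have key : ∀ w ∈ (K ∪ A)ᶜ, HasLogOn (fun x => (x - z₁) / (x - w)) K →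
      connectedComponentIn (K ∪ A)ᶜ z₁ ≠ connectedComponentIn (K ∪ A)ᶜ w →
      ∃ (l m : ℂ → ℂ) (k : ℤ), ContinuousOn l K ∧ ContinuousOn m A ∧
        (∀ x ∈ K, Complex.exp (l x) = (x - z₁) / (x - w)) ∧
        (∀ x ∈ A, Complex.exp (m x) = (x - z₁) / (x - w)) ∧ l a = m a ∧
        l b = m b + k * (2 * Real.pi * Complex.I) ∧ k ≠ 0 := by
    intro w hw hl hne
    obtain ⟨l, hl, hle⟩ := hl
    obtain ⟨m, hm, hme⟩ := hA.hasLogOn (continuousOn_div_sub (hnA hw))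
      (fun x hx => div_sub_ne_zero (hnA h₁) (hnA hw) hx)
    have hexp : ∀ x ∈ K ∩ A, Complex.exp (l x - m x) = 1 := fun x hx => by
      rw [Complex.exp_sub, hle x hx.1, hme x hx.2,
        div_self (div_sub_ne_zero (hnA h₁) (hnA hw) hx.2)]
    obtain ⟨k, hk⟩ := Complex.exp_eq_one_iff.1
      (show Complex.exp ((l b - m b) - (l a - m a)) = 1 by
        rw [Complex.exp_sub, hexp a haK, hexp b hbK, div_one])
    refine ⟨l, fun x => m x + (l a - m a), k, hl, hm.add continuousOn_const, hle, fun x hx => ?_,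
      by ring, by rw [← hk]; ring, ?_⟩
    · rw [Complex.exp_add, hexp a haK, mul_one, hme x hx]
    · rintro rfl
      apply hne
      have hagree : ∀ x ∈ K ∩ A, l x = m x + (l a - m a) := by
        intro x hx
        rw [hKA] at hx
        rcases hx with rfl | rfl
        · ring
        · simp only [Int.cast_zero, zero_mul] at hk
          linear_combination hk
      obtain ⟨g, hgl, hgm⟩ := exists_eqOn_of_eqOn_inter (m := fun x => m x + (l a - m a)) hagree
      refine connectedComponentIn_eq_of_hasLogOn hKAc h₁ hw ⟨g, (hl.congr hgl).union_of_isClosed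
        ((hm.add continuousOn_const).congr hgm) hK.isClosed hA.isCompact.isClosed, ?_⟩
      rintro x (hx | hx)
      · rw [hgl hx, hle x hx]
      · rw [hgm hx, Complex.exp_add, hexp a haK, mul_one, hme x hx]
  obtain ⟨l, m, k, hl, hm, hle, hme, hla, hlb, hk⟩ := key z₂ h₂ hl₂ h₁₂
  obtain ⟨l', m', k', hl', hm', hle', hme', hla', hlb', hk'⟩ := key z₃ h₃ hl₃ h₁₃
  -- a combination with trivial monodromy
  obtain ⟨g, hgl, hgm⟩ := exists_eqOn_of_eqOn_inter (S := K) (T := A)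
    (l := fun x => k' * l x - k * l' x) (m := fun x => k' * m x - k * m' x) (by
      intro x hx
      rw [hKA] at hx
      rcases hx with rfl | rfl
      · rw [hla, hla']
      · rw [hlb, hlb']; ring)
  have hlog : HasLogOn
      (fun x => ((x - z₁) / (x - z₂)) ^ k' * ((x - z₁) / (x - z₃)) ^ (-k)) (K ∪ A) := by
    refine ⟨g, ContinuousOn.union_of_isClosed (ContinuousOn.congr (by fun_prop) hgl)
      (ContinuousOn.congr (by fun_prop) hgm) hK.isClosed hA.isCompact.isClosed, ?_⟩
    rintro x (hx | hx)
    · rw [hgl hx, Complex.exp_sub, Complex.exp_int_mul, Complex.exp_int_mul, hle x hx, hle' x hx]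
      simp only [zpow_neg, div_eq_mul_inv]
    · rw [hgm hx, Complex.exp_sub, Complex.exp_int_mul, Complex.exp_int_mul, hme x hx, hme' x hx]
      simp only [zpow_neg, div_eq_mul_inv]
  have hop : ∀ x, IsOpen (connectedComponentIn (K ∪ A)ᶜ x) := fun x =>
    hKAc.isClosed.isOpen_compl.connectedComponentIn
  have hfr : ∀ x, frontier (connectedComponentIn (K ∪ A)ᶜ x) ⊆ K ∪ A := fun x =>
    frontier_component_subset hKAc.isClosed rfl
  have hcl := hKAc.isClosed
  rcases isBounded_or_isBounded_of_ne hKAc h₂₃ with hb | hb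
  · have hne1 : ∀ x ∈ closure (connectedComponentIn (K ∪ A)ᶜ z₂), x - z₁ ≠ 0 := fun x hx =>
      sub_ne_zero_of_mem_closure_component hx hcl h₁ h₁₂.symm
    have hne3 : ∀ x ∈ closure (connectedComponentIn (K ∪ A)ᶜ z₂), x - z₃ ≠ 0 := fun x hx =>
      sub_ne_zero_of_mem_closure_component hx hcl h₃ h₂₃
    refine not_hasLogOn_frontier (hop z₂) hb (mem_connectedComponentIn h₂) (neg_ne_zero.2 hk')
      (u := fun x => (x - z₁) ^ k' * ((x - z₁) / (x - z₃)) ^ (-k))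
      ?_ (fun x hx => mul_ne_zero (zpow_ne_zero _ (hne1 x hx))
        (zpow_ne_zero _ (div_ne_zero (hne1 x hx) (hne3 x hx))))
      ((hlog.mono (hfr z₂)).congr fun x _ => by simp only [div_zpow, zpow_neg]; ring)
    exact (ContinuousOn.zpow₀ (by fun_prop) _ fun x hx => Or.inl (hne1 x hx)).mul
      (ContinuousOn.zpow₀ (ContinuousOn.div (by fun_prop) (by fun_prop) hne3) _
        fun x hx => Or.inl (div_ne_zero (hne1 x hx) (hne3 x hx)))
  · have hne1 : ∀ x ∈ closure (connectedComponentIn (K ∪ A)ᶜ z₃), x - z₁ ≠ 0 := fun x hx =>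
      sub_ne_zero_of_mem_closure_component hx hcl h₁ h₁₃.symm
    have hne2 : ∀ x ∈ closure (connectedComponentIn (K ∪ A)ᶜ z₃), x - z₂ ≠ 0 := fun x hx =>
      sub_ne_zero_of_mem_closure_component hx hcl h₂ h₂₃.symm
    refine not_hasLogOn_frontier (hop z₃) hb (mem_connectedComponentIn h₃) hk
      (u := fun x => (x - z₁) ^ (-k) * ((x - z₁) / (x - z₂)) ^ k')
      ?_ (fun x hx => mul_ne_zero (zpow_ne_zero _ (hne1 x hx))
        (zpow_ne_zero _ (div_ne_zero (hne1 x hx) (hne2 x hx))))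
      ((hlog.mono (hfr z₃)).congr fun x _ => by
        simp only [div_zpow, zpow_neg, inv_div]; ring)
    exact (ContinuousOn.zpow₀ (by fun_prop) _ fun x hx => Or.inl (hne1 x hx)).mul
      (ContinuousOn.zpow₀ (ContinuousOn.div (by fun_prop) (by fun_prop) hne2) _
        fun x hx => Or.inl (div_ne_zero (hne1 x hx) (hne2 x hx)))

/-- The components of `(K ∪ A)ᶜ` touching the interior of the arc `A` at one point
have all of `A` in their closure. -/
theorem IsArc.subset_closure_component {K A : Set ℂ} {a b : ℂ} (hK : IsCompact K)
    (hA : IsArc A a b) (hKA : K ∩ A = {a, b}) {z : ℂ} (hz : z ∈ (K ∪ A)ᶜ) {x : ℂ}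
    (hx : x ∈ A \ {a, b}) (hxz : x ∈ closure (connectedComponentIn (K ∪ A)ᶜ z)) :
    A ⊆ closure (connectedComponentIn (K ∪ A)ᶜ z) := by
  refine hA.subset_closure_diff.trans (closure_minimal (fun p hp => ?_) isClosed_closure)
  by_contra hpF
  have hcl : IsClosed (K ∪ A) := (hK.union hA.isCompact).isClosed
  have hAK : A \ {a, b} ⊆ Kᶜ := fun x hx hxK => hx.2 (hKA ▸ ⟨hxK, hx.1⟩)
  have hzK : z ∈ Kᶜ := fun h => hz (Or.inl h)
  have hzA : z ∉ A := fun h => hz (Or.inr h)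
  -- `z` and `p` are not separated by `K`
  have hKzp : connectedComponentIn Kᶜ z = connectedComponentIn Kᶜ p := by
    refine Eq.trans ?_ (connectedComponentIn_eq_of_isPreconnected hA.isPreconnected_diff hAK hx hp)
    refine connectedComponentIn_eq_of_isPreconnected
      (isPreconnected_connectedComponentIn.subset_closure (Set.subset_insert x _)
        (Set.insert_subset hxz subset_closure)) ?_
      (Or.inr (mem_connectedComponentIn hz)) (Or.inl rfl)
    exact Set.insert_subset (hAK hx) ((connectedComponentIn_subset _ _).trans
      (Set.compl_subset_compl.2 Set.subset_union_left))
  have hlogK := hasLogOn_of_joinedIn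
    (joinedIn_of_connectedComponentIn_eq hK.isClosed.isOpen_compl hzK (hAK hp) hKzp)
  -- cut out of `A` a neighbourhood of `p` that avoids the closure of the component
  obtain ⟨γ, hγ, rfl⟩ := hA
  rw [Path.range_diff_endpoints hγ] at hp
  obtain ⟨τ, hτ, rfl⟩ := hp
  have hnhds : γ ⁻¹' (closure (connectedComponentIn (K ∪ Set.range γ)ᶜ z))ᶜ ∈ nhds τ :=
    (isClosed_closure.isOpen_compl.preimage γ.continuous).mem_nhds hpF
  obtain ⟨s, t, ⟨hsτ, hτt⟩, hst⟩ :=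
    (mem_nhds_iff_exists_Ioo_subset' ⟨0, hτ.1⟩ ⟨1, hτ.2⟩).1 (Filter.inter_mem hnhds
      (Ioo_mem_nhds hτ.1 hτ.2))
  obtain ⟨s', hss', hs'τ⟩ := exists_between hsτ
  obtain ⟨t', hτt', ht't⟩ := exists_between hτt
  have hs'1 := (hst ⟨hss', hs'τ.trans hτt⟩).2
  have ht'1 := (hst ⟨hsτ.trans hτt', ht't⟩).2
  set A₁ := γ '' Set.Iic s' with hA₁
  set A₂ := γ '' Set.Ici t' with hA₂
  have hA₂' : A₂ = γ.symm '' Set.Iic (unitInterval.symm t') := by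
    ext w
    constructor
    · rintro ⟨u, hu, rfl⟩
      exact ⟨unitInterval.symm u, unitInterval.symm_le_symm.2 hu, by simp [Path.symm_apply]⟩
    · rintro ⟨u, hu, rfl⟩
      refine ⟨unitInterval.symm u, ?_, by simp [Path.symm_apply]⟩
      rw [Set.mem_Ici, ← unitInterval.symm_le_symm, unitInterval.symm_symm]; exact hu
  have hA₁c : IsCompact A₁ := isClosed_Iic.isCompact.image γ.continuous
  have hA₂c : IsCompact A₂ := isClosed_Ici.isCompact.image γ.continuous
  have hA₁s : A₁ ⊆ Set.range γ := Set.image_subset_range _ _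
  have hA₂s : A₂ ⊆ Set.range γ := Set.image_subset_range _ _
  have hp₁ : γ τ ∉ A₁ := by
    rintro ⟨u, hu, h⟩; rw [hγ h] at hu; exact not_le_of_gt hs'τ hu
  have hp₂ : γ τ ∉ A₂ := by
    rintro ⟨u, hu, h⟩; rw [hγ h] at hu; exact not_le_of_gt hτt' hu
  have hl₁ : HasLogOn (fun x => (x - z) / (x - γ τ)) A₁ := hasLogOn_image_Iic hγ s'
    (continuousOn_div_sub hp₁) fun x hx => div_sub_ne_zero (fun h => hzA (hA₁s h)) hp₁ hx
  have hl₂ : HasLogOn (fun x => (x - z) / (x - γ τ)) A₂ := by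
    rw [hA₂'] at hp₂ hA₂s ⊢
    have hγ' : Function.Injective γ.symm := hγ.comp unitInterval.symm_bijective.injective
    exact hasLogOn_image_Iic hγ' (unitInterval.symm t')
      (continuousOn_div_sub hp₂) fun x hx => div_sub_ne_zero (fun h => hzA (hA₂s h)) hp₂ hx
  have hKA₁ : K ∩ A₁ ⊆ {a} := by
    rintro w ⟨hwK, hw⟩
    have hw' : w ∈ ({a, b} : Set ℂ) := hKA ▸ ⟨hwK, hA₁s hw⟩
    rcases hw' with h | rfl
    · exact h
    · obtain ⟨u, hu, h⟩ := hw
      rw [hγ (h.trans γ.target.symm)] at hu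
      exact absurd hu (not_le_of_gt hs'1.2)
  have hKA₂ : (K ∪ A₁) ∩ A₂ ⊆ {b} := by
    rintro w ⟨hwK | hwA, hw⟩
    · have hw' : w ∈ ({a, b} : Set ℂ) := hKA ▸ ⟨hwK, hA₂s hw⟩
      rcases hw' with rfl | h
      · obtain ⟨u, hu, h⟩ := hw
        rw [hγ (h.trans γ.source.symm)] at hu
        exact absurd hu (not_le_of_gt ht'1.1)
      · exact h
    · obtain ⟨u, hu, rfl⟩ := hwA
      obtain ⟨v, hv, h⟩ := hw
      rw [hγ h] at hv
      exact absurd (hv.trans hu) (not_le_of_gt (hs'τ.trans hτt'))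
  have hlog := (hlogK.union_of_isClosed hK.isClosed hA₁c.isClosed
    (Set.subsingleton_singleton.anti hKA₁) hl₁).union_of_isClosed
    (hK.union hA₁c).isClosed hA₂c.isClosed (Set.subsingleton_singleton.anti hKA₂) hl₂
  have hSc : IsCompact (K ∪ A₁ ∪ A₂) := (hK.union hA₁c).union hA₂c
  have hsub : K ∪ A₁ ∪ A₂ ⊆ K ∪ Set.range γ :=
    Set.union_subset (Set.union_subset_union_right _ hA₁s)
    (hA₂s.trans Set.subset_union_right)
  have hpS : γ τ ∈ (K ∪ A₁ ∪ A₂)ᶜ := by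
    rintro ((h | h) | h)
    · have h' : γ τ ∈ ({a, b} : Set ℂ) := hKA ▸ ⟨h, ⟨τ, rfl⟩⟩
      rcases h' with h | h
      · exact hτ.1.ne' (hγ (h.trans γ.source.symm))
      · exact hτ.2.ne (hγ (h.trans γ.target.symm))
    · exact hp₁ h
    · exact hp₂ h
  have hzS : z ∈ (K ∪ A₁ ∪ A₂)ᶜ := fun h => hz (hsub h)
  have heq := connectedComponentIn_eq_of_hasLogOn hSc hzS hpS hlog
  -- but the component of `z` is relatively closed outside the shortened set
  have hsubF : connectedComponentIn (K ∪ A₁ ∪ A₂)ᶜ z ⊆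
      connectedComponentIn (K ∪ Set.range γ)ᶜ z := by
    refine isPreconnected_connectedComponentIn.subset_of_closure_inter_subset
      hcl.isOpen_compl.connectedComponentIn
      ⟨z, mem_connectedComponentIn hzS, mem_connectedComponentIn hz⟩ ?_
    rintro y ⟨hy, hyS⟩
    by_contra hyF
    have hyfr : y ∈ frontier (connectedComponentIn (K ∪ Set.range γ)ᶜ z) := by
      rw [hcl.isOpen_compl.connectedComponentIn.frontier_eq]; exact ⟨hy, hyF⟩
    have hyS' := connectedComponentIn_subset _ _ hyS
    rcases frontier_component_subset hcl rfl hyfr with h | ⟨u, rfl⟩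
    · exact hyS' (Or.inl (Or.inl h))
    · refine (hst ⟨?_, ?_⟩).1 hy
      · refine hss'.trans (lt_of_not_ge fun h => hyS' (Or.inl (Or.inr ⟨u, h, rfl⟩)))
      · exact (lt_of_not_ge fun h => hyS' (Or.inr ⟨u, h, rfl⟩)).trans ht't
  exact connectedComponentIn_subset _ _ (hsubF (heq ▸ mem_connectedComponentIn hpS))
    (Or.inr ⟨τ, rfl⟩)

/-! ### Faces of a drawing and the edges on their boundaries -/

theorem connectedComponentIn_compl_frontier {F : Set ℂ} (hF : IsOpen F) (hc : IsPreconnected F)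
    {z : ℂ} (hz : z ∈ F) : connectedComponentIn (frontier F)ᶜ z = F := by
  have hsub : F ⊆ (frontier F)ᶜ := fun x hx h => by
    rw [hF.frontier_eq] at h; exact h.2 hx
  refine Set.Subset.antisymm ?_ (hc.subset_connectedComponentIn hz hsub)
  refine isPreconnected_connectedComponentIn.subset_of_closure_inter_subset hF
    ⟨z, mem_connectedComponentIn (hsub hz), hz⟩ ?_
  rintro x ⟨hx, hx'⟩
  by_contra hxF
  exact connectedComponentIn_subset _ _ hx' (by rw [hF.frontier_eq]; exact ⟨hx, hxF⟩)

namespace PlaneDrawing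

variable {V : Type*} {G : SimpleGraph V} (D : PlaneDrawing G)

theorem carrier_top : D.carrier ⊤ = Set.range D.point ∪ ⋃ e ∈ G.edgeSet, D.arc e := by
  simp [carrier]

/-- The drawing obtained by erasing an edge. -/
def deleteEdge (e : Sym2 V) : PlaneDrawing (G.deleteEdges {e}) where
  point := D.point
  arc := D.arc
  point_injective := D.point_injective
  isArc u v h := D.isArc u v (G.deleteEdges_le _ h)
  mem_of_point_mem e' he' := D.mem_of_point_mem e' (edgeSet_mono (G.deleteEdges_le _) he')
  inter_subset e₁ h₁ e₂ h₂ := D.inter_subset e₁ (edgeSet_mono (G.deleteEdges_le _) h₁) e₂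
    (edgeSet_mono (G.deleteEdges_le _) h₂)

theorem carrier_deleteEdge_union {e : Sym2 V} (he : e ∈ G.edgeSet) :
    (D.deleteEdge e).carrier ⊤ ∪ D.arc e = D.carrier ⊤ := by
  rw [carrier_top, carrier_top]
  ext x
  simp only [deleteEdge, edgeSet_deleteEdges, Set.mem_union, Set.mem_range, Set.mem_iUnion,
    Set.mem_sdiff, Set.mem_singleton_iff, exists_prop]
  constructor
  · rintro ((h | ⟨e', h, hx⟩) | hx)
    · exact Or.inl h
    · exact Or.inr ⟨e', h.1, hx⟩
    · exact Or.inr ⟨e, he, hx⟩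
  · rintro (h | ⟨e', h, hx⟩)
    · exact Or.inl (Or.inl h)
    · by_cases hee : e' = e
      · exact Or.inr (hee ▸ hx)
      · exact Or.inl (Or.inr ⟨e', ⟨h, hee⟩, hx⟩)

theorem carrier_deleteEdge_inter {u v : V} (h : G.Adj u v) :
    (D.deleteEdge s(u, v)).carrier ⊤ ∩ D.arc s(u, v) = {D.point u, D.point v} := by
  rw [carrier_top]
  ext x
  constructor
  · rintro ⟨hx, hxe⟩
    have : ∃ w, D.point w = x := by
      rcases hx with ⟨w, rfl⟩ | hx
      · exact ⟨w, rfl⟩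
      · simp only [deleteEdge, edgeSet_deleteEdges, Set.mem_iUnion, Set.mem_sdiff,
          Set.mem_singleton_iff, exists_prop] at hx
        obtain ⟨e', he', hx⟩ := hx
        exact D.inter_subset e' he'.1 _ h he'.2 ⟨hx, hxe⟩
    obtain ⟨w, rfl⟩ := this
    rcases Sym2.mem_iff.1 (D.mem_of_point_mem _ h w hxe) with rfl | rfl
    · exact Or.inl rfl
    · exact Or.inr rfl
  · rintro (rfl | rfl)
    · exact ⟨Or.inl ⟨u, rfl⟩, (D.isArc u v h).left_mem⟩
    · exact ⟨Or.inl ⟨v, rfl⟩, (D.isArc u v h).right_mem⟩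

theorem exists_isArc {e : Sym2 V} (he : e ∈ G.edgeSet) :
    ∃ u v, e = s(u, v) ∧ G.Adj u v ∧ IsArc (D.arc e) (D.point u) (D.point v) := by
  induction e with
  | h u v => exact ⟨u, v, rfl, he, D.isArc u v he⟩

theorem isCompact_arc {e : Sym2 V} (he : e ∈ G.edgeSet) : IsCompact (D.arc e) := by
  obtain ⟨u, v, -, -, h⟩ := D.exists_isArc he
  exact h.isCompact

theorem arc_subset_carrier {e : Sym2 V} (he : e ∈ G.edgeSet) : D.arc e ⊆ D.carrier ⊤ := by
  rw [carrier_top]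
  exact (Set.subset_biUnion_of_mem (u := D.arc) he).trans Set.subset_union_right

theorem point_mem_arc {e : Sym2 V} (he : e ∈ G.edgeSet) {v : V} (hv : v ∈ e) :
    D.point v ∈ D.arc e := by
  obtain ⟨u, w, rfl, -, h⟩ := D.exists_isArc he
  rcases Sym2.mem_iff.1 hv with rfl | rfl
  · exact h.left_mem
  · exact h.right_mem

theorem notMem_range_point {u v : V} (h : G.Adj u v) {x : ℂ}
    (hx : x ∈ D.arc s(u, v) \ {D.point u, D.point v}) : x ∉ Set.range D.point := by
  rintro ⟨w, rfl⟩
  apply hx.2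
  rcases Sym2.mem_iff.1 (D.mem_of_point_mem _ h w hx.1) with rfl | rfl
  · exact Or.inl rfl
  · exact Or.inr rfl

theorem isCompact_carrier [Finite V] : IsCompact (D.carrier ⊤) := by
  rw [carrier_top]
  exact (Set.finite_range _).isCompact.union
    ((Set.toFinite G.edgeSet).isCompact_biUnion fun e he => D.isCompact_arc he)

theorem interior_carrier [Finite V] : interior (D.carrier ⊤) = ∅ := by
  have hfin : ∀ S : Set (Sym2 V), S.Finite → S ⊆ G.edgeSet →
      interior (⋃ e ∈ S, D.arc e) = ∅ := by
    intro S hS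
    induction S, hS using Set.Finite.induction_on with
    | empty => simp
    | @insert e S _ hS ih =>
      intro h
      obtain ⟨u, v, -, -, h'⟩ := D.exists_isArc (h (Set.mem_insert _ _))
      rw [Set.biUnion_insert, interior_union_isClosed_of_interior_empty h'.isCompact.isClosed
        (ih ((Set.subset_insert _ _).trans h)), h'.interior_eq_empty]
  rw [carrier_top, interior_union_isClosed_of_interior_empty (Set.finite_range _).isClosed
    (hfin _ (Set.toFinite _) subset_rfl), interior_eq_empty_iff_dense_compl]
  exact (Set.finite_range _).countable.dense_compl ℝ

section Face

variable {D} {F F' : Set ℂ}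

theorem IsFace.isPreconnected (hF : D.IsFace F) : IsPreconnected F := by
  obtain ⟨x, -, rfl⟩ := hF
  exact isPreconnected_connectedComponentIn

theorem IsFace.nonempty (hF : D.IsFace F) : F.Nonempty := by
  obtain ⟨x, hx, rfl⟩ := hF
  exact ⟨x, mem_connectedComponentIn hx⟩

theorem IsFace.subset_compl (hF : D.IsFace F) : F ⊆ (D.carrier ⊤)ᶜ := by
  obtain ⟨x, hx, rfl⟩ := hF
  exact connectedComponentIn_subset _ _

theorem IsFace.connectedComponentIn_eq (hF : D.IsFace F) {z : ℂ} (hz : z ∈ F) :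
    connectedComponentIn (D.carrier ⊤)ᶜ z = F := by
  obtain ⟨x, hx, rfl⟩ := hF
  exact (_root_.connectedComponentIn_eq hz).symm

theorem IsFace.eq_of_mem (hF : D.IsFace F) (hF' : D.IsFace F') {z : ℂ} (hz : z ∈ F)
    (hz' : z ∈ F') : F = F' := by
  rw [← hF.connectedComponentIn_eq hz, ← hF'.connectedComponentIn_eq hz']

theorem isFace_connectedComponentIn {x : ℂ} (hx : x ∈ (D.carrier ⊤)ᶜ) :
    D.IsFace (connectedComponentIn (D.carrier ⊤)ᶜ x) := ⟨x, hx, rfl⟩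

variable (D) in
/-- The edges on the boundary of a face: those whose whole arc lies in its frontier. -/
def boundaryEdges (F : Set ℂ) : Set (Sym2 V) := {e ∈ G.edgeSet | D.arc e ⊆ frontier F}

theorem IsFace.connectedComponentIn_deleteEdge (hF : D.IsFace F) {u v : V} (h : G.Adj u v)
    (he : s(u, v) ∈ D.boundaryEdges F) {z q : ℂ} (hz : z ∈ F)
    (hq : q ∈ D.arc s(u, v) \ {D.point u, D.point v}) :
    connectedComponentIn ((D.deleteEdge s(u, v)).carrier ⊤)ᶜ z =
      connectedComponentIn ((D.deleteEdge s(u, v)).carrier ⊤)ᶜ q := by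
  refine connectedComponentIn_eq_of_isPreconnected
    (hF.isPreconnected.subset_closure (Set.subset_insert q _)
      (Set.insert_subset (he.2 hq.1).1 subset_closure)) ?_ (Or.inr hz) (Or.inl rfl)
  refine Set.insert_subset (fun hqK => hq.2 ?_) (hF.subset_compl.trans ?_)
  · rw [← D.carrier_deleteEdge_inter h]; exact ⟨hqK, hq.1⟩
  · rw [← D.carrier_deleteEdge_union he.1]
    exact Set.compl_subset_compl.2 Set.subset_union_left

variable (D) in
theorem hasLogOn_compl_carrier {u v : V} (h : G.Reachable u v) :
    HasLogOn (fun z => (z - D.point u) / (z - D.point v)) (D.carrier ⊤)ᶜ := by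
  have hne : ∀ (w) (z : ℂ), z ∈ (D.carrier ⊤)ᶜ → z - D.point w ≠ 0 := by
    intro w z hz h0
    rw [sub_eq_zero.1 h0, carrier_top] at hz
    exact hz (Or.inl ⟨w, rfl⟩)
  obtain ⟨p⟩ := h
  induction p with
  | nil => exact ⟨fun _ => 0, continuousOn_const, fun z hz => by simp [div_self (hne _ z hz)]⟩
  | cons h p ih =>
    refine (((D.isArc _ _ h).hasLogOn_compl.mono
      (Set.compl_subset_compl.2 (D.arc_subset_carrier h))).mul ih).congr fun z hz => ?_
    exact div_mul_div_cancel₀ (hne _ z hz)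

variable [Finite V]

theorem IsFace.isOpen (hF : D.IsFace F) : IsOpen F := by
  obtain ⟨x, -, rfl⟩ := hF
  exact D.isCompact_carrier.isClosed.isOpen_compl.connectedComponentIn

theorem IsFace.frontier_subset (hF : D.IsFace F) : frontier F ⊆ D.carrier ⊤ := by
  obtain ⟨x, -, h⟩ := hF
  exact frontier_component_subset D.isCompact_carrier.isClosed h

theorem IsFace.mem_frontier (hF : D.IsFace F) {x : ℂ} (hx : x ∈ closure F)
    (hxK : x ∈ D.carrier ⊤) : x ∈ frontier F := by
  rw [hF.isOpen.frontier_eq]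
  exact ⟨hx, fun h => hF.subset_compl h hxK⟩

/-- A face that comes close to an inner point of an edge has the whole edge on its boundary. -/
theorem IsFace.mem_boundaryEdges (hF : D.IsFace F) {e : Sym2 V} (he : e ∈ G.edgeSet) {x : ℂ}
    (hx : x ∈ D.arc e) (hxp : x ∉ Set.range D.point) (hxF : x ∈ closure F) :
    e ∈ D.boundaryEdges F := by
  refine ⟨he, fun y hy => hF.mem_frontier ?_ (D.arc_subset_carrier he hy)⟩
  obtain ⟨z, hz⟩ := hF.nonempty
  have hzK := hF.subset_compl hz
  rw [← hF.connectedComponentIn_eq hz, ← D.carrier_deleteEdge_union he] at hxF ⊢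
  rw [← D.carrier_deleteEdge_union he] at hzK
  obtain ⟨u, v, rfl, huv, hA⟩ := D.exists_isArc he
  refine hA.subset_closure_component (D.deleteEdge _).isCompact_carrier
    (D.carrier_deleteEdge_inter huv) hzK ⟨hx, ?_⟩ hxF hy
  rintro (rfl | rfl)
  · exact hxp ⟨u, rfl⟩
  · exact hxp ⟨v, rfl⟩

theorem isClosed_biUnion_arc {S : Set (Sym2 V)} (hS : S ⊆ G.edgeSet) :
    IsClosed (⋃ e ∈ S, D.arc e) :=
  ((Set.toFinite S).isCompact_biUnion fun _ he => D.isCompact_arc (hS he)).isClosed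

/-- If no vertex is isolated, a vertex on the frontier of a face is the end of an edge on its
boundary. Otherwise a small punctured disc around it lies in the face and misses all edges. -/
theorem IsFace.exists_mem_boundaryEdges (hF : D.IsFace F) (hG : ∀ v, ∃ w, G.Adj v w) {v : V}
    (hv : D.point v ∈ frontier F) : ∃ e ∈ D.boundaryEdges F, v ∈ e := by
  by_contra! hcon
  have hT : IsClosed ((⋃ e ∈ D.boundaryEdges F, D.arc e) ∪ (Set.range D.point \ {D.point v})) :=
    (isClosed_biUnion_arc fun e he => he.1).union ((Set.finite_range _).sdiff).isClosed
  have hvT : D.point v ∉ (⋃ e ∈ D.boundaryEdges F, D.arc e) ∪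
      (Set.range D.point \ {D.point v}) := by
    rintro (h | h)
    · simp only [Set.mem_iUnion, exists_prop] at h
      obtain ⟨e, he, h⟩ := h
      exact hcon e he (D.mem_of_point_mem e he.1 v h)
    · exact h.2 rfl
  obtain ⟨r, hr, hball⟩ := Metric.isOpen_iff.1 hT.isOpen_compl _ hvT
  have hfr : ∀ x ∈ Metric.ball (D.point v) r, x ≠ D.point v → x ∉ frontier F := by
    intro x hx hxv hxF
    have hxK := hF.frontier_subset hxF
    rw [carrier_top] at hxK
    by_cases hxp : x ∈ Set.range D.point
    · exact hball hx (Or.inr ⟨hxp, hxv⟩)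
    · rcases hxK with h | h
      · exact hxp h
      · simp only [Set.mem_iUnion, exists_prop] at h
        obtain ⟨e, he, hxe⟩ := h
        exact hball hx (Or.inl (Set.mem_biUnion (hF.mem_boundaryEdges he hxe hxp hxF.1) hxe))
  have hmeet : ((Metric.ball (D.point v) r \ {D.point v}) ∩ F).Nonempty := by
    obtain ⟨x, hx, hxF⟩ := mem_closure_iff.1 hv.1 _ Metric.isOpen_ball (Metric.mem_ball_self hr)
    refine ⟨x, ⟨hx, ?_⟩, hxF⟩
    rintro rfl
    rw [hF.isOpen.frontier_eq] at hv
    exact hv.2 hxF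
  have hsub : Metric.ball (D.point v) r \ {D.point v} ⊆ F := by
    refine (isPreconnected_ball_diff_singleton _ r).subset_of_closure_inter_subset
      hF.isOpen hmeet ?_
    rintro x ⟨hx, hx'⟩
    by_contra hxF
    exact hfr x hx'.1 hx'.2 (by rw [hF.isOpen.frontier_eq]; exact ⟨hx, hxF⟩)
  obtain ⟨w, hw⟩ := hG v
  obtain ⟨x, hx, hxA⟩ := mem_closure_iff.1
    ((D.isArc v w hw).subset_closure_diff (D.isArc v w hw).left_mem) _ Metric.isOpen_ball
    (Metric.mem_ball_self hr)
  exact hF.subset_compl (hsub ⟨hx, fun h => hxA.2 (Or.inl h)⟩) (D.arc_subset_carrier hw hxA.1)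

theorem IsFace.frontier_eq (hF : D.IsFace F) (hG : ∀ v, ∃ w, G.Adj v w) :
    frontier F = ⋃ e ∈ D.boundaryEdges F, D.arc e := by
  apply Set.Subset.antisymm
  · intro x hx
    have hxK := hF.frontier_subset hx
    by_cases hxp : x ∈ Set.range D.point
    · obtain ⟨v, rfl⟩ := hxp
      obtain ⟨e, he, hve⟩ := hF.exists_mem_boundaryEdges hG hx
      exact Set.mem_biUnion he (D.point_mem_arc he.1 hve)
    · rw [carrier_top] at hxK
      rcases hxK with h | h
      · exact absurd h hxp
      · simp only [Set.mem_iUnion, exists_prop] at h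
        obtain ⟨e, he, hxe⟩ := h
        exact Set.mem_biUnion (hF.mem_boundaryEdges he hxe hxp hx.1) hxe
  · exact Set.iUnion₂_subset fun e he => he.2

theorem IsFace.nonempty_boundaryEdges [Nonempty V] (hF : D.IsFace F)
    (hG : ∀ v, ∃ w, G.Adj v w) : (D.boundaryEdges F).Nonempty := by
  by_contra h
  have hfr := hF.frontier_eq hG
  rw [Set.not_nonempty_iff_eq_empty.1 h, Set.biUnion_empty, frontier_eq_empty_iff] at hfr
  rcases hfr with rfl | rfl
  · exact Set.not_nonempty_empty hF.nonempty
  · obtain ⟨v⟩ := ‹Nonempty V›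
    exact hF.subset_compl (Set.mem_univ (D.point v)) (by rw [carrier_top]; exact Or.inl ⟨v, rfl⟩)

/-- An edge is on the boundary of at most two faces. -/
theorem not_three_faces {F₁ F₂ F₃ : Set ℂ} (h₁ : D.IsFace F₁) (h₂ : D.IsFace F₂)
    (h₃ : D.IsFace F₃) {e : Sym2 V} (he₁ : e ∈ D.boundaryEdges F₁) (he₂ : e ∈ D.boundaryEdges F₂)
    (he₃ : e ∈ D.boundaryEdges F₃) (h₁₂ : F₁ ≠ F₂) (h₁₃ : F₁ ≠ F₃) (h₂₃ : F₂ ≠ F₃) : False := by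
  obtain ⟨u, v, rfl, huv, hA⟩ := D.exists_isArc he₁.1
  obtain ⟨q, hq⟩ := hA.nonempty_diff
  obtain ⟨z₁, hz₁⟩ := h₁.nonempty
  obtain ⟨z₂, hz₂⟩ := h₂.nonempty
  obtain ⟨z₃, hz₃⟩ := h₃.nonempty
  have hK := (D.deleteEdge s(u, v)).isCompact_carrier
  have key : ∀ {F : Set ℂ} (_ : D.IsFace F) {z} (_ : z ∈ F),
      z ∈ ((D.deleteEdge s(u, v)).carrier ⊤ ∪ D.arc s(u, v))ᶜ := fun hF z hz => by
    rw [D.carrier_deleteEdge_union huv]; exact hF.subset_compl hz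
  have hlog : ∀ {F : Set ℂ} (_ : D.IsFace F) (_ : s(u, v) ∈ D.boundaryEdges F) {z} (_ : z ∈ F),
      HasLogOn (fun x => (x - z₁) / (x - z)) ((D.deleteEdge s(u, v)).carrier ⊤) :=
    fun hF he z hz => hasLogOn_of_joinedIn (joinedIn_of_connectedComponentIn_eq
      hK.isClosed.isOpen_compl (fun h => key h₁ hz₁ (Or.inl h)) (fun h => key hF hz (Or.inl h))
      ((h₁.connectedComponentIn_deleteEdge huv he₁ hz₁ hq).trans
        (hF.connectedComponentIn_deleteEdge huv he hz hq).symm))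
  refine hA.not_three_components hK (D.carrier_deleteEdge_inter huv) (key h₁ hz₁) (key h₂ hz₂)
    (key h₃ hz₃) (hlog h₂ he₂ hz₂) (hlog h₃ he₃ hz₃) ?_ ?_ ?_ <;>
  rw [D.carrier_deleteEdge_union huv]
  · rwa [h₁.connectedComponentIn_eq hz₁, h₂.connectedComponentIn_eq hz₂]
  · rwa [h₁.connectedComponentIn_eq hz₁, h₃.connectedComponentIn_eq hz₃]
  · rwa [h₂.connectedComponentIn_eq hz₂, h₃.connectedComponentIn_eq hz₃]

variable (D) in
/-- An edge that is not a bridge splits a face of the drawing without that edge. -/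
theorem exists_ne_of_reachable_deleteEdge {u v : V} (h : G.Adj u v)
    (hr : (G.deleteEdges {s(u, v)}).Reachable u v) {q : ℂ}
    (hq : q ∈ D.arc s(u, v) \ {D.point u, D.point v}) :
    ∃ y₁ ∈ (D.carrier ⊤)ᶜ, ∃ y₂ ∈ (D.carrier ⊤)ᶜ,
      connectedComponentIn ((D.deleteEdge s(u, v)).carrier ⊤)ᶜ y₁ =
        connectedComponentIn ((D.deleteEdge s(u, v)).carrier ⊤)ᶜ q ∧
      connectedComponentIn ((D.deleteEdge s(u, v)).carrier ⊤)ᶜ y₂ =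
        connectedComponentIn ((D.deleteEdge s(u, v)).carrier ⊤)ᶜ q ∧
      connectedComponentIn (D.carrier ⊤)ᶜ y₁ ≠ connectedComponentIn (D.carrier ⊤)ᶜ y₂ := by
  have := (D.isArc u v h).exists_ne_of_attach (D.deleteEdge s(u, v)).isCompact_carrier
    (D.carrier_deleteEdge_inter h) ((D.deleteEdge s(u, v)).hasLogOn_compl_carrier hr) hq
  rwa [D.carrier_deleteEdge_union h] at this

variable (D) in
/-- The faces into which an edge splits a face of the smaller drawing have that edge on their
boundary. -/
theorem mem_boundaryEdges_of_deleteEdge {u v : V} (h : G.Adj u v) {q y : ℂ}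
    (hq : q ∈ D.arc s(u, v) \ {D.point u, D.point v}) (hy : y ∈ (D.carrier ⊤)ᶜ)
    (hyq : connectedComponentIn ((D.deleteEdge s(u, v)).carrier ⊤)ᶜ y =
      connectedComponentIn ((D.deleteEdge s(u, v)).carrier ⊤)ᶜ q) :
    s(u, v) ∈ D.boundaryEdges (connectedComponentIn (D.carrier ⊤)ᶜ y) := by
  have hF := isFace_connectedComponentIn hy
  have hsub : ((D.deleteEdge s(u, v)).carrier ⊤) ⊆ D.carrier ⊤ := by
    rw [← D.carrier_deleteEdge_union (G.mem_edgeSet.2 h)]; exact Set.subset_union_left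
  have hqK : q ∈ ((D.deleteEdge s(u, v)).carrier ⊤)ᶜ := fun hqK => hq.2 (by
    rw [← D.carrier_deleteEdge_inter h]; exact ⟨hqK, hq.1⟩)
  by_contra hcon
  have hC : connectedComponentIn ((D.deleteEdge s(u, v)).carrier ⊤)ᶜ y ⊆
      connectedComponentIn (D.carrier ⊤)ᶜ y := by
    refine isPreconnected_connectedComponentIn.subset_of_closure_inter_subset hF.isOpen
      ⟨y, mem_connectedComponentIn fun hy' => hy (hsub hy'), mem_connectedComponentIn hy⟩ ?_
    rintro x ⟨hx, hx'⟩
    by_contra hxF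
    have hxK : x ∈ D.carrier ⊤ := hF.frontier_subset (by
      rw [hF.isOpen.frontier_eq]; exact ⟨hx, hxF⟩)
    have hxK' := connectedComponentIn_subset _ _ hx'
    rw [← D.carrier_deleteEdge_union (G.mem_edgeSet.2 h)] at hxK
    rcases hxK with hxK | hxK
    · exact hxK' hxK
    · refine hcon (hF.mem_boundaryEdges h hxK (fun hxp => hxK' ?_) hx)
      rw [carrier_top]; exact Or.inl hxp
  exact hF.subset_compl (hC (hyq ▸ mem_connectedComponentIn hqK)) (D.arc_subset_carrier h hq.1)

variable (D) in
theorem exists_face_ne (F : Set ℂ) {u v : V} (h : G.Adj u v)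
    (hr : (G.deleteEdges {s(u, v)}).Reachable u v) :
    ∃ F', D.IsFace F' ∧ F' ≠ F ∧ s(u, v) ∈ D.boundaryEdges F' := by
  obtain ⟨q, hq⟩ := (D.isArc u v h).nonempty_diff
  obtain ⟨y₁, hy₁, y₂, hy₂, h₁, h₂, hne⟩ := D.exists_ne_of_reachable_deleteEdge h hr hq
  by_cases hF₁ : connectedComponentIn (D.carrier ⊤)ᶜ y₁ = F
  · exact ⟨_, isFace_connectedComponentIn hy₂, fun h => hne (hF₁.trans h.symm),
      D.mem_boundaryEdges_of_deleteEdge h hq hy₂ h₂⟩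
  · exact ⟨_, isFace_connectedComponentIn hy₁, hF₁,
      D.mem_boundaryEdges_of_deleteEdge h hq hy₁ h₁⟩

/-- In a bridgeless graph the boundary of a face has no dead ends: if it contained an edge `uv`
but no other edge at `v`, then `uv` would not be needed to separate the two faces at `uv`. -/
theorem IsFace.exists_ne_mem_boundaryEdges (hF : D.IsFace F) (hG : ∀ v, ∃ w, G.Adj v w) {u v : V}
    (he : s(u, v) ∈ D.boundaryEdges F) (hr : (G.deleteEdges {s(u, v)}).Reachable u v) :
    ∃ e ∈ D.boundaryEdges F, e ≠ s(u, v) ∧ v ∈ e := by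
  have h : G.Adj u v := he.1
  obtain ⟨F', hF', hne, he'⟩ := D.exists_face_ne F h hr
  by_contra! hcon
  obtain ⟨q, hq⟩ := (D.isArc u v h).nonempty_diff
  obtain ⟨z, hz⟩ := hF.nonempty
  obtain ⟨z', hz'⟩ := hF'.nonempty
  set S := D.boundaryEdges F \ {s(u, v)} with hS
  have hSG : S ⊆ G.edgeSet := fun e he => he.1.1
  set X := ⋃ e ∈ S, D.arc e with hX
  have hXc : IsClosed X := isClosed_biUnion_arc hSG
  have hXK : X ⊆ D.carrier ⊤ := Set.iUnion₂_subset fun e he => D.arc_subset_carrier (hSG he)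
  have hfr : frontier F = X ∪ D.arc s(u, v) := by
    rw [hF.frontier_eq hG, hX, hS]
    conv_lhs => rw [← Set.sdiff_union_of_subset (Set.singleton_subset_iff.2 he),
      Set.biUnion_union, Set.biUnion_singleton]
  have hqX : q ∉ X := by
    intro hqX
    simp only [hX, Set.mem_iUnion, exists_prop] at hqX
    obtain ⟨e, he, hqe⟩ := hqX
    exact D.notMem_range_point h hq (D.inter_subset e (hSG he) _ h he.2 ⟨hqe, hq.1⟩)
  have hXarc : X ∩ D.arc s(u, v) ⊆ {D.point u} := by
    rintro x ⟨hx, hx'⟩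
    simp only [hX, Set.mem_iUnion, exists_prop] at hx
    obtain ⟨e, he, hxe⟩ := hx
    obtain ⟨w, rfl⟩ := D.inter_subset e (hSG he) _ h he.2 ⟨hxe, hx'⟩
    rcases Sym2.mem_iff.1 (D.mem_of_point_mem _ h w hx') with rfl | rfl
    · rfl
    · exact absurd (D.mem_of_point_mem _ (hSG he) _ hxe) (hcon e he.1 he.2)
  have hzK := hF.subset_compl hz
  have hzK' := hF'.subset_compl hz'
  have hsame : ∀ {F₁ : Set ℂ}, D.IsFace F₁ → s(u, v) ∈ D.boundaryEdges F₁ → ∀ {y}, y ∈ F₁ →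
      connectedComponentIn Xᶜ y = connectedComponentIn Xᶜ q := fun hF₁ he₁ y hy =>
    connectedComponentIn_eq_of_isPreconnected
      (hF₁.isPreconnected.subset_closure (Set.subset_insert q _)
        (Set.insert_subset (he₁.2 hq.1).1 subset_closure))
      (Set.insert_subset hqX (hF₁.subset_compl.trans (Set.compl_subset_compl.2 hXK)))
      (Or.inr hy) (Or.inl rfl)
  have hlogX := hasLogOn_of_joinedIn (joinedIn_of_connectedComponentIn_eq hXc.isOpen_compl
    (fun h => hzK (hXK h)) (fun h => hzK' (hXK h))
    ((hsame hF he hz).trans (hsame hF' he' hz').symm))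
  have hnA : ∀ {y}, y ∈ (D.carrier ⊤)ᶜ → y ∉ D.arc s(u, v) := fun hy hy' =>
    hy (D.arc_subset_carrier h hy')
  have hlogA := (D.isArc u v h).hasLogOn (continuousOn_div_sub (z := z) (hnA hzK'))
    fun x hx => div_sub_ne_zero (hnA hzK) (hnA hzK') hx
  have hlog := hlogX.union_of_isClosed hXc (D.isCompact_arc h).isClosed
    (Set.subsingleton_singleton.anti hXarc) hlogA
  rw [← hfr] at hlog
  have hcomp : IsCompact (frontier F) :=
    D.isCompact_carrier.of_isClosed_subset isClosed_frontier hF.frontier_subset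
  have heq := connectedComponentIn_eq_of_hasLogOn hcomp (fun h => hzK (hF.frontier_subset h))
    (fun h => hzK' (hF.frontier_subset h)) hlog
  rw [connectedComponentIn_compl_frontier hF.isOpen hF.isPreconnected hz] at heq
  have hz'F : z' ∈ F := by
    rw [heq]; exact mem_connectedComponentIn fun h => hzK' (hF.frontier_subset h)
  exact hne (hF'.eq_of_mem hF hz' hz'F)

variable (D) in
/-- Adding an edge that is not a bridge increases the number of faces. -/
theorem encard_faces_deleteEdge {u v : V} (h : G.Adj u v)
    (hr : (G.deleteEdges {s(u, v)}).Reachable u v) :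
    {F | (D.deleteEdge s(u, v)).IsFace F}.encard + 1 ≤ {F | D.IsFace F}.encard := by
  have hsub : ((D.deleteEdge s(u, v)).carrier ⊤) ⊆ D.carrier ⊤ := by
    rw [← D.carrier_deleteEdge_union (G.mem_edgeSet.2 h)]; exact Set.subset_union_left
  have hex : ∀ F₀ : Set ℂ, ∃ F, (D.deleteEdge s(u, v)).IsFace F₀ → D.IsFace F ∧ F ⊆ F₀ := by
    intro F₀
    by_cases hF₀ : (D.deleteEdge s(u, v)).IsFace F₀
    · have hint : ¬ F₀ ⊆ D.carrier ⊤ := fun hF => by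
        have := interior_maximal hF hF₀.isOpen
        rw [D.interior_carrier] at this
        exact hF₀.nonempty.not_subset_empty this
      obtain ⟨x, hx, hxK⟩ := Set.not_subset.1 hint
      refine ⟨_, fun _ => ⟨isFace_connectedComponentIn hxK, ?_⟩⟩
      rw [← hF₀.connectedComponentIn_eq hx]
      exact connectedComponentIn_mono _ (Set.compl_subset_compl.2 hsub)
    · exact ⟨∅, fun h => absurd h hF₀⟩
  choose σ hσ using hex
  have hinj : Set.InjOn σ {F | (D.deleteEdge s(u, v)).IsFace F} := by
    intro F₁ h₁ F₂ h₂ h12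
    obtain ⟨z, hz⟩ := (hσ F₁ h₁).1.nonempty
    exact IsFace.eq_of_mem h₁ h₂ ((hσ F₁ h₁).2 hz) ((hσ F₂ h₂).2 (h12 ▸ hz))
  obtain ⟨q, hq⟩ := (D.isArc u v h).nonempty_diff
  obtain ⟨y₁, hy₁, y₂, hy₂, h₁, h₂, hne⟩ := D.exists_ne_of_reachable_deleteEdge h hr hq
  obtain ⟨y, hy, hyq, hyσ⟩ : ∃ y ∈ (D.carrier ⊤)ᶜ,
      connectedComponentIn ((D.deleteEdge s(u, v)).carrier ⊤)ᶜ y =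
        connectedComponentIn ((D.deleteEdge s(u, v)).carrier ⊤)ᶜ q ∧
      connectedComponentIn (D.carrier ⊤)ᶜ y ≠
        σ (connectedComponentIn ((D.deleteEdge s(u, v)).carrier ⊤)ᶜ q) := by
    by_cases hc : connectedComponentIn (D.carrier ⊤)ᶜ y₁ =
        σ (connectedComponentIn ((D.deleteEdge s(u, v)).carrier ⊤)ᶜ q)
    · exact ⟨y₂, hy₂, h₂, fun hc' => hne (hc.trans hc'.symm)⟩
    · exact ⟨y₁, hy₁, h₁, hc⟩
  have hnot : connectedComponentIn (D.carrier ⊤)ᶜ y ∉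
      σ '' {F | (D.deleteEdge s(u, v)).IsFace F} := by
    rintro ⟨F₀, hF₀, hσF⟩
    have hyF₀ : y ∈ F₀ := (hσ F₀ hF₀).2 (hσF ▸ mem_connectedComponentIn hy)
    have := IsFace.connectedComponentIn_eq hF₀ hyF₀
    rw [hyq] at this
    exact hyσ (by rw [this, hσF])
  rw [← hinj.encard_image, ← Set.encard_insert_of_notMem hnot]
  refine Set.encard_le_encard (Set.insert_subset (isFace_connectedComponentIn hy) ?_)
  rintro _ ⟨F₀, hF₀, rfl⟩
  exact (hσ F₀ hF₀).1

/-- The inequality `m + 2 ≤ n + f` of Euler's formula, by deleting non-bridges until the graph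
is a tree. -/
theorem ncard_edgeSet_add_two_le (hG : G.Connected) (D : PlaneDrawing G) :
    (G.edgeSet.ncard : ℕ∞) + 2 ≤ Nat.card V + {F | D.IsFace F}.encard := by
  induction hk : G.edgeSet.ncard using Nat.strong_induction_on generalizing G with
  | _ k ih =>
    by_cases hbr : ∃ u v, G.Adj u v ∧ ¬ G.IsBridge s(u, v)
    · obtain ⟨u, v, huv, hnb⟩ := hbr
      have hk' : (G.deleteEdges {s(u, v)}).edgeSet.ncard + 1 = k := by
        rw [edgeSet_deleteEdges, ← hk]
        exact Set.ncard_sdiff_singleton_add_one huv (Set.toFinite _)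
      have h1 := ih _ (by omega) (hG.connected_delete_edge_of_not_isBridge hnb)
        (D.deleteEdge s(u, v)) rfl
      have h2 := D.encard_faces_deleteEdge huv (by simpa [isBridge_iff] using hnb)
      calc (k : ℕ∞) + 2 = ((G.deleteEdges {s(u, v)}).edgeSet.ncard : ℕ∞) + 2 + 1 := by
            rw [← hk']; push_cast; ring
        _ ≤ Nat.card V + {F | (D.deleteEdge s(u, v)).IsFace F}.encard + 1 := by gcongr
        _ ≤ Nat.card V + {F | D.IsFace F}.encard := by rw [add_assoc]; gcongr
    · push Not at hbr
      have hT : G.IsTree := ⟨hG, isAcyclic_iff_forall_adj_isBridge.2 fun u v h => hbr u v h⟩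
      have hcard := (isTree_iff_connected_and_card.1 hT).2
      rw [Nat.card_coe_set_eq, hk] at hcard
      have hne : ((D.carrier ⊤)ᶜ).Nonempty := by
        rw [Set.nonempty_compl]
        intro h
        have := D.interior_carrier
        rw [h, interior_univ] at this
        exact Set.univ_nonempty.ne_empty this
      obtain ⟨x, hx⟩ := hne
      have h1 : 1 ≤ {F | D.IsFace F}.encard :=
        Set.one_le_encard_iff_nonempty.2 ⟨_, isFace_connectedComponentIn hx⟩
      calc (k : ℕ∞) + 2 = Nat.card V + 1 := by rw [← hcard]; push_cast; ring
        _ ≤ Nat.card V + {F | D.IsFace F}.encard := by gcongr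

end Face

end PlaneDrawing

/-! ### Boundaries with fewer than six edges -/

/-- A nonempty edge set of a bipartite graph that has no dead ends either is a 4-cycle or has at
least six edges. -/
theorem six_le_ncard_or_eq_four_cycle {V : Type*} [Finite V] {G : SimpleGraph V}
    (hbip : G.IsBipartite) {S : Set (Sym2 V)} (hSG : S ⊆ G.edgeSet) (hne : S.Nonempty)
    (hS : ∀ u v, s(u, v) ∈ S → ∃ w, w ≠ u ∧ s(v, w) ∈ S) :
    6 ≤ S.ncard ∨ ∃ a b c d, a ≠ c ∧ b ≠ d ∧ S = {s(a, b), s(b, c), s(c, d), s(d, a)} := by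
  obtain ⟨C⟩ := hbip
  obtain ⟨κ, hκ⟩ : ∃ κ : V → Bool, ∀ u v, s(u, v) ∈ S → κ v = !κ u := by
    refine ⟨fun v => decide (C v = 0), fun u v h => ?_⟩
    have h1 : C u ≠ C v := C.valid (hSG h)
    have h2 : ∀ x y : Fin 2, x ≠ y → decide (y = 0) = !decide (x = 0) := by decide
    exact h2 _ _ h1
  have hsix : ∀ e₁ e₂ e₃ e₄ e₅ e₆ : Sym2 V, e₁ ∈ S → e₂ ∈ S → e₃ ∈ S → e₄ ∈ S → e₅ ∈ S → e₆ ∈ S →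
      [e₁, e₂, e₃, e₄, e₅, e₆].Nodup → 6 ≤ S.ncard := by
    classical
    intro e₁ e₂ e₃ e₄ e₅ e₆ h₁ h₂ h₃ h₄ h₅ h₆ hnd
    have h := Set.ncard_le_ncard (s := (↑([e₁, e₂, e₃, e₄, e₅, e₆].toFinset) : Set (Sym2 V)))
      (t := S) (by
        intro e he
        simp only [List.coe_toFinset, List.mem_cons, List.not_mem_nil, or_false, Set.mem_ofPred_eq]
          at he
        rcases he with rfl | rfl | rfl | rfl | rfl | rfl <;> assumption) (Set.toFinite S)
    rwa [Set.ncard_coe_finset, List.toFinset_card_of_nodup hnd] at h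
  -- an edge of `S` with an end `x` off the cycle comes with a second edge at `x`
  have hcycle : ∀ a b c d, a ≠ c → b ≠ d → s(a, b) ∈ S → s(b, c) ∈ S → s(c, d) ∈ S → s(d, a) ∈ S →
      6 ≤ S.ncard ∨ S = {s(a, b), s(b, c), s(c, d), s(d, a)} := by
    intro a b c d hac hbd h₁ h₂ h₃ h₄
    by_cases hex : ∃ x y, s(x, y) ∈ S ∧ x ≠ a ∧ x ≠ b ∧ x ≠ c ∧ x ≠ d
    · obtain ⟨x, y, hxy, hxa, hxb, hxc, hxd⟩ := hex
      obtain ⟨z, hzy, hz⟩ := hS y x (Sym2.eq_swap ▸ hxy)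
      refine Or.inl (hsix _ _ _ _ _ _ h₁ h₂ h₃ h₄ hxy hz ?_)
      have := hκ _ _ h₁
      have := hκ _ _ h₂
      have := hκ _ _ h₃
      have := hκ _ _ h₄
      have := hκ _ _ hxy
      have := hκ _ _ hz
      simp only [List.nodup_cons, List.mem_cons, Sym2.eq_iff, List.not_mem_nil, List.nodup_nil,
        and_true, or_false]
      clear hsix hS hκ hne h₁ h₂ h₃ h₄ hxy hz hSG
      grind
    · push Not at hex
      right
      apply Set.Subset.antisymm
      · intro e he
        induction e with
        | h x y =>
          have h5 : x = a ∨ x = b ∨ x = c ∨ x = d := by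
            have := hex x y he
            tauto
          have h6 : y = a ∨ y = b ∨ y = c ∨ y = d := by
            have := hex y x (Sym2.eq_swap ▸ he)
            tauto
          have := hκ _ _ h₁
          have := hκ _ _ h₂
          have := hκ _ _ h₃
          have := hκ _ _ h₄
          have := hκ _ _ he
          simp only [Set.mem_insert_iff, Set.mem_singleton_iff, Sym2.eq_iff]
          clear hsix hS hκ hne h₁ h₂ h₃ h₄ he hSG hex
          grind
      · rintro e (rfl | rfl | rfl | rfl) <;> assumption
  obtain ⟨e, he⟩ := hne
  induction e with
  | h a b =>
    obtain ⟨c, hca, hbc⟩ := hS a b he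
    obtain ⟨d, hdb, had⟩ := hS b a (Sym2.eq_swap ▸ he)
    obtain ⟨x, hxa, hdx⟩ := hS a d had
    obtain ⟨y, hyb, hcy⟩ := hS b c hbc
    by_cases hxc : x = c
    · subst hxc
      exact (hcycle a b x d hca.symm hdb.symm he hbc (Sym2.eq_swap ▸ hdx)
        (Sym2.eq_swap ▸ had)).imp_right fun h => ⟨a, b, x, d, hca.symm, hdb.symm, h⟩
    by_cases hyd : y = d
    · subst hyd
      exact (hcycle a b c y hca.symm hdb.symm he hbc hcy
        (Sym2.eq_swap ▸ had)).imp_right fun h => ⟨a, b, c, y, hca.symm, hdb.symm, h⟩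
    obtain ⟨w, hwd, hxw⟩ := hS d x hdx
    refine Or.inl (hsix _ _ _ _ _ _ he hbc had hdx hcy hxw ?_)
    have := hκ _ _ he
    have := hκ _ _ hbc
    have := hκ _ _ had
    have := hκ _ _ hdx
    have := hκ _ _ hcy
    have := hκ _ _ hxw
    simp only [List.nodup_cons, List.mem_cons, Sym2.eq_iff, List.not_mem_nil, List.nodup_nil,
      and_true, or_false]
    clear hsix hS hκ hcycle he hbc had hdx hcy hxw hSG
    grind (splits := 40)

theorem mem_mem_four_cycle {V : Type*} {a b c d t : V} (hab : a ≠ b) (hbc : b ≠ c) (hcd : c ≠ d)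
    (hda : d ≠ a) (hac : a ≠ c) (hbd : b ≠ d) :
    (t ∈ s(a, b) → t ∈ s(b, c) → t = b) ∧ ¬ (t ∈ s(a, b) ∧ t ∈ s(c, d)) ∧
    (t ∈ s(b, c) → t ∈ s(c, d) → t = c) ∧ (t ∈ s(a, b) → t ∈ s(d, a) → t = a) ∧
    ¬ (t ∈ s(b, c) ∧ t ∈ s(d, a)) ∧ (t ∈ s(c, d) → t ∈ s(d, a) → t = d) := by
  simp only [Sym2.mem_iff]
  grind

theorem nodup_four_cycle {V : Type*} {a b c d : V} (hab : a ≠ b) (hbc : b ≠ c) (hcd : c ≠ d)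
    (hda : d ≠ a) (hac : a ≠ c) (hbd : b ≠ d) :
    [s(a, b), s(b, c), s(c, d), s(d, a)].Nodup ∧ [b, c, d, a].Nodup := by
  simp only [List.nodup_cons, List.mem_cons, Sym2.eq_iff, List.not_mem_nil, List.nodup_nil,
    and_true, or_false]
  grind

namespace PlaneDrawing

variable {V : Type*} {G : SimpleGraph V} {D : PlaneDrawing G}

/-- Distinct faces are not bounded by the same four edges if there is a vertex `w` off these edges:
`w` would lie in a third component of the complement of a closed curve. -/
theorem IsFace.eq_of_frontier_eq_four_cycle [Finite V] {F F' : Set ℂ} (hF : D.IsFace F)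
    (hF' : D.IsFace F') {a b c d w : V} (hab : G.Adj a b) (hbc : G.Adj b c) (hcd : G.Adj c d)
    (hda : G.Adj d a) (hac : a ≠ c) (hbd : b ≠ d)
    (hfr : frontier F = D.arc s(a, b) ∪ D.arc s(b, c) ∪ D.arc s(c, d) ∪ D.arc s(d, a))
    (hfr' : frontier F' = frontier F) (hwa : w ≠ a) (hwb : w ≠ b) (hwc : w ≠ c) (hwd : w ≠ d) :
    F = F' := by
  by_contra hne
  have hab' := hab.ne
  have hbc' := hbc.ne
  have hcd' := hcd.ne
  have hda' := hda.ne
  have hclosed : ∀ {u v}, G.Adj u v → IsClosed (D.arc s(u, v)) := fun h =>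
    (D.isCompact_arc (G.mem_edgeSet.2 h)).isClosed
  have hinter : ∀ {u v u' v'}, G.Adj u v → G.Adj u' v' → s(u, v) ≠ s(u', v') → ∀ x,
      x ∈ D.arc s(u, v) → x ∈ D.arc s(u', v') →
      ∃ t, D.point t = x ∧ t ∈ s(u, v) ∧ t ∈ s(u', v') := by
    intro u v u' v' h h' hn x hx hx'
    obtain ⟨t, rfl⟩ := D.inter_subset _ h _ h' hn ⟨hx, hx'⟩
    exact ⟨t, rfl, D.mem_of_point_mem _ h t hx, D.mem_of_point_mem _ h' t hx'⟩
  have hleft : ∀ {u v}, G.Adj u v → D.point u ∈ D.arc s(u, v) := fun h => (D.isArc _ _ h).left_mem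
  have hright : ∀ {u v}, G.Adj u v → D.point v ∈ D.arc s(u, v) := fun h => (D.isArc _ _ h).right_mem
  have hnd := (nodup_four_cycle hab' hbc' hcd' hda' hac hbd).1
  simp only [List.nodup_cons, List.mem_cons, List.not_mem_nil, List.nodup_nil, and_true, or_false,
    not_or, not_false_eq_true] at hnd
  obtain ⟨⟨n₁, n₂, n₃⟩, ⟨n₄, n₅⟩, n₆⟩ := hnd
  have hmem := fun t => mem_mem_four_cycle (t := t) hab' hbc' hcd' hda' hac hbd
  have hI₁ : (D.arc s(a, b) ∩ D.arc s(b, c)) ⊆ {D.point b} := by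
    rintro x ⟨hx, hx'⟩
    obtain ⟨t, rfl, h1, h2⟩ := hinter hab hbc n₁ x hx hx'
    rw [(hmem t).1 h1 h2]; rfl
  have hI₂ : ((D.arc s(a, b) ∪ D.arc s(b, c)) ∩ D.arc s(c, d)) ⊆ {D.point c} := by
    rintro x ⟨hx | hx, hx'⟩
    · obtain ⟨t, rfl, h1, h2⟩ := hinter hab hcd n₂ x hx hx'
      exact absurd ⟨h1, h2⟩ (hmem t).2.1
    · obtain ⟨t, rfl, h1, h2⟩ := hinter hbc hcd n₄ x hx hx'
      rw [(hmem t).2.2.1 h1 h2]; rfl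
  have hI₃ : (D.arc s(a, b) ∪ D.arc s(b, c) ∪ D.arc s(c, d)) ∩ D.arc s(d, a) =
      {D.point d, D.point a} := by
    apply Set.Subset.antisymm
    · rintro x ⟨(hx | hx) | hx, hx'⟩
      · obtain ⟨t, rfl, h1, h2⟩ := hinter hab hda n₃ x hx hx'
        rw [(hmem t).2.2.2.1 h1 h2]; exact Or.inr rfl
      · obtain ⟨t, rfl, h1, h2⟩ := hinter hbc hda n₅ x hx hx'
        exact absurd ⟨h1, h2⟩ (hmem t).2.2.2.2.1
      · obtain ⟨t, rfl, h1, h2⟩ := hinter hcd hda n₆ x hx hx'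
        rw [(hmem t).2.2.2.2.2 h1 h2]; exact Or.inl rfl
    · rintro x (rfl | rfl)
      · exact ⟨Or.inr (hright hcd), hleft hda⟩
      · exact ⟨Or.inl (Or.inl (hleft hab)), hright hda⟩
  have hKc : IsCompact (D.arc s(a, b) ∪ D.arc s(b, c) ∪ D.arc s(c, d)) :=
    ((D.isCompact_arc (G.mem_edgeSet.2 hab)).union (D.isCompact_arc (G.mem_edgeSet.2 hbc))).union
      (D.isCompact_arc (G.mem_edgeSet.2 hcd))
  have hlog : ∀ z ∈ (D.arc s(a, b) ∪ D.arc s(b, c) ∪ D.arc s(c, d) ∪ D.arc s(d, a))ᶜ,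
      ∀ z' ∈ (D.arc s(a, b) ∪ D.arc s(b, c) ∪ D.arc s(c, d) ∪ D.arc s(d, a))ᶜ,
      HasLogOn (fun x => (x - z) / (x - z')) (D.arc s(a, b) ∪ D.arc s(b, c) ∪ D.arc s(c, d)) := by
    intro z hz z' hz'
    have hA : ∀ {u v}, G.Adj u v → z ∉ D.arc s(u, v) → z' ∉ D.arc s(u, v) →
        HasLogOn (fun x => (x - z) / (x - z')) (D.arc s(u, v)) := fun h h1 h2 =>
      (D.isArc _ _ h).hasLogOn (continuousOn_div_sub h2) fun x hx => div_sub_ne_zero h1 h2 hx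
    simp only [Set.compl_union, Set.mem_inter_iff, Set.mem_compl_iff] at hz hz'
    exact ((hA hab hz.1.1.1 hz'.1.1.1).union_of_isClosed (hclosed hab) (hclosed hbc)
      (Set.subsingleton_singleton.anti hI₁) (hA hbc hz.1.1.2 hz'.1.1.2)).union_of_isClosed
      ((hclosed hab).union (hclosed hbc)) (hclosed hcd) (Set.subsingleton_singleton.anti hI₂)
      (hA hcd hz.1.2 hz'.1.2)
  have hpw : ∀ {u v}, G.Adj u v → w ≠ u → w ≠ v → D.point w ∉ D.arc s(u, v) := by
    intro u v h h1 h2 h3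
    rcases Sym2.mem_iff.1 (D.mem_of_point_mem _ (G.mem_edgeSet.2 h) w h3) with h | h
    · exact h1 h
    · exact h2 h
  have hw : D.point w ∈ (D.arc s(a, b) ∪ D.arc s(b, c) ∪ D.arc s(c, d) ∪ D.arc s(d, a))ᶜ := by
    rintro (((h | h) | h) | h)
    · exact hpw hab hwa hwb h
    · exact hpw hbc hwb hwc h
    · exact hpw hcd hwc hwd h
    · exact hpw hda hwd hwa h
  have hwF : ∀ {F₁}, D.IsFace F₁ → D.point w ∉ F₁ := fun h h' =>
    h.subset_compl h' (by rw [carrier_top]; exact Or.inl ⟨w, rfl⟩)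
  obtain ⟨z, hz⟩ := hF.nonempty
  obtain ⟨z', hz'⟩ := hF'.nonempty
  have hcomp := connectedComponentIn_compl_frontier hF.isOpen hF.isPreconnected hz
  have hcomp' := connectedComponentIn_compl_frontier hF'.isOpen hF'.isPreconnected hz'
  have hzc : z ∈ (frontier F)ᶜ := fun h => hF.subset_compl hz (hF.frontier_subset h)
  have hzc' : z' ∈ (frontier F')ᶜ := fun h => hF'.subset_compl hz' (hF'.frontier_subset h)
  rw [hfr'] at hcomp' hzc'
  rw [hfr] at hcomp hcomp' hzc hzc'
  refine (D.isArc d a hda).not_three_components hKc hI₃ hzc hzc' hw (hlog _ hzc _ hzc')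
    (hlog _ hzc _ hw) ?_ ?_ ?_
  · rwa [hcomp, hcomp']
  · rw [hcomp]
    exact fun h => hwF hF (h ▸ mem_connectedComponentIn hw)
  · rw [hcomp']
    exact fun h => hwF hF' (h ▸ mem_connectedComponentIn hw)

/-- The 4-cycle through four given vertices. -/
theorem exists_isFourCycle {a b c d : V} (hab : G.Adj a b) (hbc : G.Adj b c) (hcd : G.Adj c d)
    (hda : G.Adj d a) (hac : a ≠ c) (hbd : b ≠ d) :
    ∃ C : G.Subgraph, IsFourCycle C ∧
      ∀ D : PlaneDrawing G, D.carrier C =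
        D.arc s(a, b) ∪ D.arc s(b, c) ∪ D.arc s(c, d) ∪ D.arc s(d, a) := by
  let p : G.Walk a a := .cons hab (.cons hbc (.cons hcd (.cons hda .nil)))
  have hab' := hab.ne
  have hbc' := hbc.ne
  have hcd' := hcd.ne
  have hda' := hda.ne
  refine ⟨p.toSubgraph, ⟨a, p, ?_, rfl, rfl⟩, fun D => ?_⟩
  · have hnd := nodup_four_cycle hab' hbc' hcd' hda' hac hbd
    rw [Walk.isCycle_def, Walk.isTrail_def]
    exact ⟨by simpa only [p, Walk.edges_cons, Walk.edges_nil] using hnd.1, by simp [p],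
      by simpa only [p, Walk.support_cons, Walk.support_nil, List.tail_cons] using hnd.2⟩
  · have hE : ∀ e, e ∈ p.toSubgraph.edgeSet ↔
        e ∈ ({s(a, b), s(b, c), s(c, d), s(d, a)} : Set _) := by
      intro e
      rw [Walk.mem_edges_toSubgraph]
      simp [p]
    have hV : D.point '' p.toSubgraph.verts ⊆ ⋃ e ∈ p.toSubgraph.edgeSet, D.arc e := by
      rintro _ ⟨x, hx, rfl⟩
      have hx' : ∃ e ∈ p.toSubgraph.edgeSet, x ∈ e := by
        simp only [hE]
        rw [Walk.mem_verts_toSubgraph] at hx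
        simp only [p, Walk.support_cons, Walk.support_nil, List.mem_cons, List.not_mem_nil,
          or_false] at hx
        rcases hx with rfl | rfl | rfl | rfl | rfl <;> simp
      obtain ⟨e, he, hxe⟩ := hx'
      exact Set.mem_biUnion he (D.point_mem_arc (p.toSubgraph.edgeSet_subset he) hxe)
    rw [carrier, Set.union_eq_self_of_subset_left hV, Set.ext hE]
    simp only [Set.biUnion_insert, Set.biUnion_singleton, ← Set.union_assoc]

end PlaneDrawing

/-! ### Degrees and bridges in braces -/

section Brace

variable {V : Type*} {G : SimpleGraph V}

theorem MatchingsExtend.exists_adj_adj (hG : MatchingsExtend G 2) {x x' y y' : V}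
    (hx : G.Adj x x') (hy : G.Adj y y') (h₁ : x ≠ y) (h₂ : x ≠ y') (h₃ : x' ≠ y) (h₄ : x' ≠ y') :
    ∃ P : G.Subgraph, P.IsPerfectMatching ∧ P.Adj x x' ∧ P.Adj y y' := by
  obtain ⟨P, hP, hMP⟩ := hG (G.subgraphOfAdj hx ⊔ G.subgraphOfAdj hy)
    ((Subgraph.IsMatching.subgraphOfAdj hx).sup (Subgraph.IsMatching.subgraphOfAdj hy) (by
      rw [support_subgraphOfAdj, support_subgraphOfAdj]
      simp [h₁.symm, h₂.symm, h₃.symm, h₄.symm]))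
    (by
      rw [Subgraph.edgeSet_sup, edgeSet_subgraphOfAdj, edgeSet_subgraphOfAdj]
      refine (Set.encard_union_le _ _).trans ?_
      rw [Set.encard_singleton, Set.encard_singleton]
      norm_num)
  exact ⟨P, hP, hMP.2 (Or.inl (subgraphOfAdj_adj_self hx)),
    hMP.2 (Or.inr (subgraphOfAdj_adj_self hy))⟩

theorem MatchingsExtend.exists_adj (hG : MatchingsExtend G 2) {x x' : V} (hx : G.Adj x x') :
    ∃ P : G.Subgraph, P.IsPerfectMatching ∧ P.Adj x x' := by
  obtain ⟨P, hP, hMP⟩ := hG (G.subgraphOfAdj hx) (Subgraph.IsMatching.subgraphOfAdj hx)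
    (by
      rw [edgeSet_subgraphOfAdj, Set.encard_singleton]
      norm_num)
  exact ⟨P, hP, hMP.2 (subgraphOfAdj_adj_self hx)⟩

theorem SimpleGraph.Subgraph.IsPerfectMatching.eq_of_adj {P : G.Subgraph}
    (hP : P.IsPerfectMatching) {u v w : V} (h : P.Adj u v) (h' : P.Adj u w) : v = w :=
  (Subgraph.isPerfectMatching_iff.1 hP u).unique h h'

theorem SimpleGraph.Connected.eq_univ_of_adj_closed (hG : G.Connected) {S : Set V}
    (hne : S.Nonempty) (hS : ∀ u ∈ S, ∀ w, G.Adj u w → w ∈ S) : S = Set.univ := by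
  obtain ⟨u, hu⟩ := hne
  refine Set.eq_univ_of_forall fun v => ?_
  obtain ⟨p⟩ := hG.preconnected u v
  induction p with
  | nil => exact hu
  | cons h p ih => exact ih (hS _ hu _ h)

theorem SimpleGraph.IsBipartite.not_triangle (hG : G.IsBipartite) {u v w : V} (huv : G.Adj u v)
    (hvw : G.Adj v w) (huw : G.Adj u w) : False := by
  obtain ⟨C⟩ := hG
  have h : ∀ x y z : Fin 2, x ≠ y → y ≠ z → x ≠ z → False := by decide
  exact h _ _ _ (C.valid huv) (C.valid hvw) (C.valid huw)

theorem SimpleGraph.Connected.exists_adj_notMem [Finite V] (hG : G.Connected) {S : Set V}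
    (hne : S.Nonempty) (hcard : S.ncard < Nat.card V) : ∃ u ∈ S, ∃ w ∉ S, G.Adj u w := by
  by_contra! hcon
  have := hG.eq_univ_of_adj_closed hne fun u hu w h => by
    by_contra hw
    exact hcon u hu w hw h
  rw [this, Set.ncard_univ] at hcard
  exact lt_irrefl _ hcard

theorem ncard_insert_four_le (a b c d : V) : ({a, b, c, d} : Set V).ncard ≤ 4 :=
  (Set.ncard_insert_le _ _).trans (Nat.succ_le_succ ((Set.ncard_insert_le _ _).trans
    (Nat.succ_le_succ ((Set.ncard_insert_le _ _).trans (by simp)))))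

variable [Finite V]

theorem exists_adj_ne_of_matchingsExtend (hconn : G.Connected) (hcard : 6 ≤ Nat.card V)
    (hG : MatchingsExtend G 2) (v x : V) : ∃ y, y ≠ x ∧ G.Adj v y := by
  by_contra! hcon
  have hx : ∀ y, G.Adj v y → y = x := fun y h => by
    by_contra h'
    exact hcon y h' h
  obtain ⟨u, hu, w, hw, huw⟩ := hconn.exists_adj_notMem (S := {v, x}) ⟨v, Or.inl rfl⟩
    (lt_of_le_of_lt ((Set.ncard_insert_le _ _).trans (by simp)) (by omega : 2 < Nat.card V))
  have hu' : u = x := by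
    rcases hu with rfl | h
    · exact absurd (Or.inr (hx w huw)) hw
    · exact h
  subst hu'
  obtain ⟨P, hP, huw'⟩ := hG.exists_adj huw
  obtain ⟨t, ht, -⟩ := Subgraph.isPerfectMatching_iff.1 hP v
  have := hx t ht.adj_sub
  subst this
  exact hw (Or.inl (hP.eq_of_adj huw' ht.symm))

theorem exists_adj_ne_ne_of_matchingsExtend (hconn : G.Connected) (hbip : G.IsBipartite)
    (hcard : 6 ≤ Nat.card V) (hG : MatchingsExtend G 2) (v x y : V) :
    ∃ z, z ≠ x ∧ z ≠ y ∧ G.Adj v z := by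
  by_contra! hcon
  have hxy' : ∀ z, G.Adj v z → z = x ∨ z = y := fun z h => by
    by_contra! h'
    exact hcon z h'.1 h'.2 h
  have hdeg := exists_adj_ne_of_matchingsExtend hconn hcard hG
  obtain ⟨hvx, hvy, hxy⟩ : G.Adj v x ∧ G.Adj v y ∧ x ≠ y := by
    obtain ⟨s, hs, hvs⟩ := hdeg v x
    obtain ⟨t, ht, hvt⟩ := hdeg v y
    have h1 := (hxy' s hvs).resolve_left hs
    have h2 := (hxy' t hvt).resolve_right ht
    subst h1 h2
    exact ⟨hvt, hvs, hs.symm⟩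
  obtain ⟨x', hx'v, hxx'⟩ := hdeg x v
  obtain ⟨y', hy'v, hyy'⟩ := hdeg y v
  have hx'y : x' ≠ y := by
    rintro rfl
    exact hbip.not_triangle hvx hxx' hvy
  have hy'x : x ≠ y' := by
    rintro rfl
    exact hbip.not_triangle hvy hyy' hvx
  -- two matching edges that use up both neighbours of `v`
  have key : ∀ p q, p ≠ v → q ≠ v → G.Adj x p → G.Adj y q → p = q := by
    intro p q hp hq hxp hyq
    by_contra hpq
    obtain ⟨P, hP, h1, h2⟩ := hG.exists_adj_adj hxp hyq hxy
      (by rintro rfl; exact hbip.not_triangle hvy hyq hvx)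
      (by rintro rfl; exact hbip.not_triangle hvx hxp hvy) hpq
    obtain ⟨t, ht, -⟩ := Subgraph.isPerfectMatching_iff.1 hP v
    rcases hxy' t ht.adj_sub with rfl | rfl
    · exact hp (hP.eq_of_adj h1 ht.symm)
    · exact hq (hP.eq_of_adj h2 ht.symm)
  have hx'y' := key x' y' hx'v hy'v hxx' hyy'
  subst hx'y'
  have hNx : ∀ p, G.Adj x p → p = v ∨ p = x' := fun p hp => by
    by_contra! h
    exact h.2 (key p x' h.1 hx'v hp hyy')
  have hNy : ∀ p, G.Adj y p → p = v ∨ p = x' := fun p hp => by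
    by_contra! h
    exact h.2 (key x' p hx'v h.1 hxx' hp).symm
  -- otherwise `v`, `x`, `y`, `x'` form a 4-cycle that can only be left at `x'`
  obtain ⟨u, hu, w, hw, huw⟩ := hconn.exists_adj_notMem (S := {v, x, y, x'}) ⟨v, Or.inl rfl⟩
    (lt_of_le_of_lt (ncard_insert_four_le _ _ _ _) (by omega))
  simp only [Set.mem_insert_iff, Set.mem_singleton_iff, not_or] at hu hw
  have hu' : u = x' := by
    rcases hu with rfl | rfl | rfl | rfl
    · exact ((hxy' w huw).elim hw.2.1 hw.2.2.1).elim
    · exact ((hNx w huw).elim hw.1 hw.2.2.2).elim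
    · exact ((hNy w huw).elim hw.1 hw.2.2.2).elim
    · rfl
  subst hu'
  obtain ⟨P, hP, huw'⟩ := hG.exists_adj huw
  have hpart : ∀ s, s ≠ w → (∀ p, G.Adj s p → p = v ∨ p = u) → P.Adj v s := by
    intro s hs hN
    obtain ⟨t, ht, -⟩ := Subgraph.isPerfectMatching_iff.1 hP s
    rcases hN t ht.adj_sub with rfl | rfl
    · exact ht.symm
    · exact absurd (hP.eq_of_adj ht.symm huw') hs
  exact hxy (hP.eq_of_adj (hpart x (Ne.symm hw.2.1) hNx) (hpart y (Ne.symm hw.2.2.1) hNy))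

theorem three_le_degree_of_matchingsExtend [Fintype V] [DecidableRel G.Adj] (hconn : G.Connected)
    (hbip : G.IsBipartite) (hcard : 6 ≤ Nat.card V) (hG : MatchingsExtend G 2) (v : V) :
    3 ≤ G.degree v := by
  classical
  obtain ⟨x, -, hx⟩ := exists_adj_ne_of_matchingsExtend hconn hcard hG v v
  obtain ⟨y, hyx, hy⟩ := exists_adj_ne_of_matchingsExtend hconn hcard hG v x
  obtain ⟨z, hzx, hzy, hz⟩ := exists_adj_ne_ne_of_matchingsExtend hconn hbip hcard hG v x y
  have hsub : ({x, y, z} : Finset V) ⊆ G.neighborFinset v := by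
    intro w hw
    simp only [Finset.mem_insert, Finset.mem_singleton] at hw
    rw [mem_neighborFinset]
    rcases hw with rfl | rfl | rfl <;> assumption
  have := Finset.card_le_card hsub
  rwa [Finset.card_eq_three.2 ⟨x, y, z, hyx.symm, hzx.symm, hzy.symm, rfl⟩,
    card_neighborFinset_eq_degree] at this

/-- A perfect matching pairs up the elements of a set that contains the partner of each of its
elements. -/
theorem SimpleGraph.Subgraph.IsPerfectMatching.even_ncard {P : G.Subgraph}
    (hP : P.IsPerfectMatching) {S : Set V} (hS : ∀ u ∈ S, ∀ w, P.Adj u w → w ∈ S) :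
    Even S.ncard := by
  classical
  choose f hf _ using Subgraph.isPerfectMatching_iff.1 hP
  have := Fintype.ofFinite V
  rw [Set.ncard_eq_toFinset_card']
  have h := Finset.sum_involution (s := S.toFinset) (f := fun _ => (1 : ZMod 2)) (fun a _ => f a)
    (fun _ _ => by decide) (fun a _ _ => (hf a).adj_sub.ne')
    (fun a ha => by
      rw [Set.mem_toFinset] at ha ⊢
      exact hS a ha _ (hf a))
    (fun a _ => hP.eq_of_adj (hf (f a)) (hf a).symm)
  rw [Finset.sum_const, nsmul_eq_mul, mul_one] at h
  exact (ZMod.natCast_eq_zero_iff_even).1 h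

/-- If `uv` were a bridge, then the side of `u` would have odd size because of a perfect matching
through `uv`, and even size because of one through another edge at `u`. -/
theorem reachable_deleteEdges_of_matchingsExtend (hconn : G.Connected) (hcard : 6 ≤ Nat.card V)
    (hG : MatchingsExtend G 2) {u v : V} (h : G.Adj u v) :
    (G.deleteEdges {s(u, v)}).Reachable u v := by
  by_contra hcon
  set S : Set V := {w | (G.deleteEdges {s(u, v)}).Reachable u w} with hS
  have huS : u ∈ S := Reachable.refl u
  have hvS : v ∉ S := hcon
  have hstep : ∀ a ∈ S, ∀ b, G.Adj a b → s(a, b) ≠ s(u, v) → b ∈ S := fun a ha b hab hne =>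
    Reachable.trans ha (Adj.reachable (by simp [deleteEdges_adj, hab, hne]))
  obtain ⟨P, hP, huv⟩ := hG.exists_adj h
  obtain ⟨u', hu'v, huu'⟩ := exists_adj_ne_of_matchingsExtend hconn hcard hG u v
  obtain ⟨Q, hQ, hQu⟩ := hG.exists_adj huu'
  have hodd : Even (insert v S).ncard := by
    refine hP.even_ncard fun a ha b hab => ?_
    rcases ha with rfl | ha
    · rw [hP.eq_of_adj hab huv.symm]; exact Or.inr huS
    · by_cases hab' : s(a, b) = s(u, v)
      · rcases Sym2.eq_iff.1 hab' with ⟨-, rfl⟩ | ⟨rfl, -⟩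
        · exact Or.inl rfl
        · exact absurd ha hvS
      · exact Or.inr (hstep a ha b hab.adj_sub hab')
  have heven : Even S.ncard := by
    refine hQ.even_ncard fun a ha b hab => hstep a ha b hab.adj_sub fun hab' => ?_
    rcases Sym2.eq_iff.1 hab' with ⟨rfl, rfl⟩ | ⟨rfl, -⟩
    · exact hu'v (hQ.eq_of_adj hQu hab)
    · exact hvS ha
  rw [Set.ncard_insert_of_notMem hvS] at hodd
  exact (Nat.even_add_one.1 hodd) heven

/-! ### Counting faces -/

open Classical in
/-- With `m ≥ 3n/2` edges, `f ≥ m - n + 2` faces, two faces at each edge, and six edges around each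
face that is not bounded by a 4-cycle, at least six faces are bounded by a 4-cycle. -/
theorem six_le_encard_facialFourCycles (hconn : G.Connected) (hbip : G.IsBipartite)
    (hcard : 6 ≤ Nat.card V) (hG : MatchingsExtend G 2) (D : PlaneDrawing G) :
    6 ≤ D.facialFourCycles.encard := by
  have := Fintype.ofFinite V
  have hnt : Nonempty V := by
    rw [← not_isEmpty_iff]; intro h; simp at hcard
  have hiso : ∀ v, ∃ w, G.Adj v w := fun v =>
    (exists_adj_ne_of_matchingsExtend hconn hcard hG v v).imp fun _ h => h.2
  have hbr := fun {u v : V} (h : G.Adj u v) =>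
    reachable_deleteEdges_of_matchingsExtend hconn hcard hG h
  -- each face is bounded by a 4-cycle or has at least six edges
  have hface : ∀ F, D.IsFace F → 6 ≤ (D.boundaryEdges F).ncard ∨
      (D.boundaryEdges F).ncard = 4 ∧ ∃ C : G.Subgraph, (IsFourCycle C ∧ frontier F = D.carrier C) ∧
        ∀ F', D.IsFace F' → frontier F' = frontier F → F = F' := by
    intro F hF
    refine (six_le_ncard_or_eq_four_cycle hbip (S := D.boundaryEdges F) (fun e he => he.1)
      (hF.nonempty_boundaryEdges hiso) fun u v h => ?_).imp_right ?_
    · obtain ⟨e, he, hne, hv⟩ := hF.exists_ne_mem_boundaryEdges hiso h (hbr h.1)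
      obtain ⟨w, rfl⟩ := Sym2.mem_iff_exists.1 hv
      exact ⟨w, fun hw => hne (by rw [hw, Sym2.eq_swap]), he⟩
    · rintro ⟨a, b, c, d, hac, hbd, hS⟩
      have hadj : ∀ {x y}, s(x, y) ∈ ({s(a, b), s(b, c), s(c, d), s(d, a)} : Set (Sym2 V)) →
          G.Adj x y := fun h => (hS ▸ h : _ ∈ D.boundaryEdges F).1
      have hab : G.Adj a b := hadj (by simp)
      have hbc : G.Adj b c := hadj (by simp)
      have hcd : G.Adj c d := hadj (by simp)
      have hda : G.Adj d a := hadj (by simp)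
      have hfr : frontier F = D.arc s(a, b) ∪ D.arc s(b, c) ∪ D.arc s(c, d) ∪ D.arc s(d, a) := by
        rw [hF.frontier_eq hiso, hS]
        simp only [Set.biUnion_insert, Set.biUnion_singleton, ← Set.union_assoc]
      obtain ⟨C, hC, hCD⟩ := PlaneDrawing.exists_isFourCycle hab hbc hcd hda hac hbd
      refine ⟨?_, C, ⟨hC, by rw [hCD, hfr]⟩, fun F' hF' hFF' => ?_⟩
      · have hnd := (nodup_four_cycle hab.ne hbc.ne hcd.ne hda.ne hac hbd).1
        rw [hS, show ({s(a, b), s(b, c), s(c, d), s(d, a)} : Set (Sym2 V)) =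
          ↑([s(a, b), s(b, c), s(c, d), s(d, a)].toFinset) by ext; simp, Set.ncard_coe_finset,
          List.toFinset_card_of_nodup hnd]
        rfl
      · obtain ⟨w, hw⟩ : ∃ w, w ∉ ({a, b, c, d} : Set V) := by
          by_contra! hall
          have h4 := ncard_insert_four_le a b c d
          rw [Set.eq_univ_of_forall hall, Set.ncard_univ] at h4
          omega
        simp only [Set.mem_insert_iff, Set.mem_singleton_iff, not_or] at hw
        exact hF.eq_of_frontier_eq_four_cycle hF' hab hbc hcd hda hac hbd hfr hFF'
          hw.1 hw.2.1 hw.2.2.1 hw.2.2.2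
  have htwo : ∀ e, {F | D.IsFace F ∧ e ∈ D.boundaryEdges F}.encard ≤ 2 := by
    intro e
    by_contra! hlt
    obtain ⟨T, hT, hT3⟩ := Set.exists_subset_encard_eq (Order.add_one_le_of_lt hlt)
    obtain ⟨F₁, F₂, F₃, h₁₂, h₁₃, h₂₃, rfl⟩ := Set.encard_eq_three.1 (hT3.trans (by norm_num))
    have h₁ := hT (Or.inl rfl)
    have h₂ := hT (Or.inr (Or.inl rfl))
    have h₃ := hT (Or.inr (Or.inr rfl))
    exact PlaneDrawing.not_three_faces h₁.1 h₂.1 h₃.1 h₁.2 h₂.2 h₃.2 h₁₂ h₁₃ h₂₃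
  have hfin : {F | D.IsFace F}.Finite := by
    refine (Set.Finite.biUnion (Set.toFinite G.edgeSet) fun e _ =>
      Set.finite_of_encard_le_coe (htwo e)).subset fun F hF => ?_
    obtain ⟨e, he⟩ := PlaneDrawing.IsFace.nonempty_boundaryEdges hF hiso
    exact Set.mem_biUnion he.1 ⟨hF, he⟩
  set Φ := hfin.toFinset with hΦ
  have hΦmem : ∀ F, F ∈ Φ ↔ D.IsFace F := fun F => by simp [hΦ]
  -- double counting of incident pairs of faces and edges
  have hdouble : ∑ F ∈ Φ, (D.boundaryEdges F).ncard ≤ G.edgeFinset.card * 2 := by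
    have h1 : ∀ F, (D.boundaryEdges F).ncard =
        (Finset.bipartiteAbove (fun F e => e ∈ D.boundaryEdges F) G.edgeFinset F).card := by
      intro F
      rw [← Set.ncard_coe_finset]
      congr 1
      ext e
      simp only [Finset.bipartiteAbove, Finset.coe_filter, mem_edgeFinset, Set.mem_ofPred_eq]
      exact ⟨fun h => ⟨h.1, h⟩, fun h => h.2⟩
    simp_rw [h1]
    rw [Finset.sum_card_bipartiteAbove_eq_sum_card_bipartiteBelow]
    refine Finset.sum_le_card_nsmul _ _ _ fun e _ => ?_
    have h2 := htwo e
    have h3 : {F | D.IsFace F ∧ e ∈ D.boundaryEdges F} =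
        ↑(Finset.bipartiteBelow (fun F e => e ∈ D.boundaryEdges F) Φ e) := by
      ext F
      simp [Finset.bipartiteBelow, hΦmem]
    rw [h3, Set.encard_coe_eq_coe_finsetCard] at h2
    exact_mod_cast h2
  have heuler := PlaneDrawing.ncard_edgeSet_add_two_le hconn D
  rw [← hfin.coe_toFinset, Set.encard_coe_eq_coe_finsetCard, ← hΦ, ← coe_edgeFinset,
    Set.ncard_coe_finset] at heuler
  have heuler' : G.edgeFinset.card + 2 ≤ Fintype.card V + Φ.card := by
    rw [← Nat.card_eq_fintype_card]; exact_mod_cast heuler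
  have hdeg : Fintype.card V * 3 ≤ 2 * G.edgeFinset.card := by
    rw [← sum_degrees_eq_twice_card_edges]
    exact Finset.card_nsmul_le_sum _ _ _ fun v _ =>
      three_le_degree_of_matchingsExtend hconn hbip hcard hG v
  set A := Φ.filter fun F => (D.boundaryEdges F).ncard = 4 with hA
  have hsum : 4 * A.card + 6 * (Φ.filter fun F => ¬ (D.boundaryEdges F).ncard = 4).card ≤
      ∑ F ∈ Φ, (D.boundaryEdges F).ncard := by
    rw [← Finset.sum_filter_add_sum_filter_not Φ fun F => (D.boundaryEdges F).ncard = 4]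
    refine add_le_add ?_ ?_
    · rw [mul_comm, ← smul_eq_mul]
      exact Finset.card_nsmul_le_sum _ _ _ fun F hF => (Finset.mem_filter.1 hF).2.ge
    · rw [mul_comm, ← smul_eq_mul]
      refine Finset.card_nsmul_le_sum _ _ _ fun F hF => ?_
      obtain ⟨hF, h4⟩ := Finset.mem_filter.1 hF
      exact (hface F ((hΦmem F).1 hF)).resolve_right fun h => h4 h.1
  have hsplit := Finset.card_filter_add_card_filter_not (s := Φ)
    (fun F => (D.boundaryEdges F).ncard = 4)
  have hA6 : 6 ≤ A.card := by
    rw [← hA] at hsplit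
    omega
  -- faces with four edges yield distinct facial 4-cycles
  have hex : ∀ F, ∃ C : G.Subgraph, F ∈ A → (IsFourCycle C ∧ frontier F = D.carrier C) ∧
        ∀ F', D.IsFace F' → frontier F' = frontier F → F = F' := by
    intro F
    by_cases hF : F ∈ A
    · obtain ⟨hFΦ, h4⟩ := Finset.mem_filter.1 hF
      rcases hface F ((hΦmem F).1 hFΦ) with h | h
      · omega
      · obtain ⟨C, hC⟩ := h.2
        exact ⟨C, fun _ => hC⟩
    · exact ⟨⊥, fun h => absurd h hF⟩
  choose σ hσ using hex
  have hAface : ∀ F ∈ A, D.IsFace F := fun F hF => (hΦmem F).1 (Finset.mem_filter.1 hF).1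
  have hinj : Set.InjOn σ (A : Set (Set ℂ)) := fun F hF F' hF' h =>
    (hσ F hF).2 F' (hAface F' hF') (by rw [(hσ F hF).1.2, (hσ F' hF').1.2, h])
  calc (6 : ℕ∞) ≤ (A : Set (Set ℂ)).encard := by
        rw [Set.encard_coe_eq_coe_finsetCard]; exact_mod_cast hA6
    _ = (σ '' A).encard := hinj.encard_image.symm
    _ ≤ D.facialFourCycles.encard := Set.encard_le_encard (by
        rintro _ ⟨F, hF, rfl⟩
        exact ⟨(hσ F hF).1.1, F, hAface F hF, (hσ F hF).1.2⟩)

end Brace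

/-! ### The cube -/

namespace Cube

/-- The vertex next to `x` in direction `i`. -/
def flip (i : Fin 3) (x : Fin 3 → Bool) : Fin 3 → Bool := Function.update x i (!x i)

@[simp] theorem flip_same (i : Fin 3) (x : Fin 3 → Bool) : flip i x i = !x i := by simp [flip]

theorem flip_of_ne {i j : Fin 3} (h : j ≠ i) (x : Fin 3 → Bool) : flip i x j = x j := by
  simp [flip, h]

@[simp] theorem flip_flip (i : Fin 3) (x : Fin 3 → Bool) : flip i (flip i x) = x := by
  simp [flip]

theorem flip_comm (i j : Fin 3) (x : Fin 3 → Bool) : flip i (flip j x) = flip j (flip i x) := by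
  by_cases h : i = j
  · rw [h]
  · funext k
    by_cases hi : k = i
    · subst hi; rw [flip_same, flip_of_ne h, flip_of_ne h, flip_same]
    · rw [flip_of_ne hi]
      by_cases hj : k = j
      · subst hj; rw [flip_same, flip_same, flip_of_ne hi]
      · rw [flip_of_ne hj, flip_of_ne hj, flip_of_ne hi]

theorem flip_left_injective {i j : Fin 3} {x : Fin 3 → Bool} (h : flip i x = flip j x) : i = j := by
  by_contra hij
  have := congrFun h i
  rw [flip_same, flip_of_ne hij] at this
  simp at this

theorem exists_third (i j : Fin 3) : ∃ t, t ≠ i ∧ t ≠ j := by decide +revert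

theorem eq_or_eq_or_eq {i j t : Fin 3} (hij : i ≠ j) (hti : t ≠ i) (htj : t ≠ j) (m : Fin 3) :
    m = i ∨ m = j ∨ m = t := by decide +revert

theorem adj_iff {x y : Fin 3 → Bool} : cubeGraph.Adj x y ↔ ∃ i, y = flip i x := by
  change hammingDist x y = 1 ↔ _
  rw [hammingDist, Finset.card_eq_one]
  constructor
  · rintro ⟨i, hi⟩
    refine ⟨i, funext fun j => ?_⟩
    have hj := Finset.ext_iff.1 hi j
    simp only [Finset.mem_filter, Finset.mem_univ, true_and, Finset.mem_singleton] at hj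
    by_cases hji : j = i
    · subst hji
      rw [flip_same, Bool.eq_not]
      exact fun h => (hj.2 rfl) h.symm
    · rw [flip_of_ne hji]
      by_contra h
      exact hji (hj.1 (Ne.symm h))
  · rintro ⟨i, rfl⟩
    refine ⟨i, Finset.ext fun j => ?_⟩
    simp only [Finset.mem_filter, Finset.mem_univ, true_and, Finset.mem_singleton]
    by_cases hji : j = i
    · subst hji; simp
    · simp [flip_of_ne hji, hji]

theorem adj_flip (i : Fin 3) (x : Fin 3 → Bool) : cubeGraph.Adj x (flip i x) := adj_iff.2 ⟨i, rfl⟩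

theorem connected : cubeGraph.Connected := by
  have hstep : ∀ (x : Fin 3 → Bool) i b, cubeGraph.Reachable x (Function.update x i b) := by
    intro x i b
    by_cases h : x i = b
    · subst h; rw [Function.update_eq_self]
    · rw [show b = !x i from (Bool.eq_not.2 (Ne.symm h))]
      exact (adj_flip i x).reachable
  refine (connected_iff _).2 ⟨fun x y => ?_, ⟨fun _ => true⟩⟩
  have hy : y = Function.update (Function.update (Function.update x 0 (y 0)) 1 (y 1)) 2 (y 2) := by
    funext i
    fin_cases i <;> rfl
  rw [hy]
  exact ((hstep _ _ _).trans (hstep _ _ _)).trans (hstep _ _ _)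

theorem isBipartite : cubeGraph.IsBipartite := by
  refine ⟨Coloring.mk (fun x => if (x 0 ^^ x 1 ^^ x 2) then 1 else 0) ?_⟩
  intro x y h
  obtain ⟨i, rfl⟩ := adj_iff.1 h
  have h2 : ∀ b : Bool, (if b then (1 : Fin 2) else 0) ≠ if !b then 1 else 0 := by decide
  convert h2 (x 0 ^^ x 1 ^^ x 2) using 2
  fin_cases i <;> simp [flip]

theorem card_eq : Nat.card (Fin 3 → Bool) = 8 := by simp

theorem isEmpty_iso_cycleGraph : IsEmpty (cubeGraph ≃g cycleGraph 4) :=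
  ⟨fun φ => by
    have := Nat.card_congr φ.toEquiv
    simp at this⟩

/-- The perfect matching in which each vertex `x` is joined to its neighbour in direction `f x`. -/
def directionMatching (f : (Fin 3 → Bool) → Fin 3) (hf : ∀ x, f (flip (f x) x) = f x) :
    cubeGraph.Subgraph where
  verts := Set.univ
  Adj x y := y = flip (f x) x
  adj_sub h := h ▸ adj_flip _ _
  edge_vert _ := Set.mem_univ _
  symm := ⟨fun x y h => by subst h; rw [hf, flip_flip]⟩

theorem directionMatching_isPerfectMatching (f : (Fin 3 → Bool) → Fin 3)
    (hf : ∀ x, f (flip (f x) x) = f x) : (directionMatching f hf).IsPerfectMatching :=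
  Subgraph.isPerfectMatching_iff.2 fun _ => ⟨_, rfl, fun _ h => h⟩

/-- Two edges of a matching in different directions `a`, `b` lie on opposite faces of the
cube. -/
theorem ne_of_isMatching {M : cubeGraph.Subgraph} (hM : M.IsMatching) {x y : Fin 3 → Bool}
    {a b t : Fin 3} (hab : a ≠ b) (hta : t ≠ a) (htb : t ≠ b) (hx : M.Adj x (flip a x))
    (hy : M.Adj y (flip b y)) : x t ≠ y t := by
  intro hxy
  have key : ∀ {z v c}, M.Adj z (flip c z) → (∀ i, i ≠ c → v i = z i) → M.Adj v (flip c v) := by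
    intro z v c hz hv
    by_cases hvc : v c = z c
    · have : v = z := funext fun i => by
        by_cases h : i = c
        · rw [h, hvc]
        · exact hv i h
      rwa [this]
    · have : v = flip c z := funext fun i => by
        by_cases h : i = c
        · subst h; rw [flip_same, Bool.eq_not]; exact hvc
        · rw [flip_of_ne h, hv i h]
      rw [this, flip_flip]
      exact hz.symm
  -- a common vertex of the two edges
  have h1 := key (v := Function.update x a (y a)) hx fun i hi => by simp [hi]
  have h2 := key (v := Function.update x a (y a)) hy fun i hi => by
    by_cases hia : i = a
    · subst hia; simp
    · rw [Function.update_of_ne hia]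
      have : i = t := by omega
      rw [this, hxy]
  exact hab (flip_left_injective ((hM h1.fst_mem).unique h1 h2))

theorem matchingsExtend : MatchingsExtend cubeGraph 2 := by
  intro M hM hcard
  by_cases hdir : ∃ a, ∀ x y, M.Adj x y → y = flip a x
  · obtain ⟨a, ha⟩ := hdir
    exact ⟨_, directionMatching_isPerfectMatching (fun _ => a) fun _ => rfl,
      Set.subset_univ _, fun x y h => ha x y h⟩
  · push Not at hdir
    obtain ⟨x, x', hx, -⟩ := hdir 0
    obtain ⟨a, rfl⟩ := adj_iff.1 hx.adj_sub
    obtain ⟨y, y', hy, hya⟩ := hdir a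
    obtain ⟨b, rfl⟩ := adj_iff.1 hy.adj_sub
    have hab : a ≠ b := by rintro rfl; exact hya rfl
    obtain ⟨t, hta, htb⟩ := exists_third a b
    have hxy := ne_of_isMatching hM hab hta htb hx hy
    let f : (Fin 3 → Bool) → Fin 3 := fun z => if z t = x t then a else b
    have hf : ∀ z, f (flip (f z) z) = f z := by
      intro z
      by_cases h : z t = x t
      · simp [f, h, flip_of_ne hta]
      · simp [f, h, flip_of_ne htb]
    have hne : s(x, flip a x) ≠ s(y, flip b y) := by
      intro h
      rcases Sym2.eq_iff.1 h with ⟨rfl, -⟩ | ⟨h, -⟩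
      · exact hxy rfl
      · rw [h, flip_of_ne htb] at hxy
        exact hxy rfl
    have hM2 : M.edgeSet = {s(x, flip a x), s(y, flip b y)} :=
      (Set.Finite.eq_of_subset_of_encard_le (Set.toFinite _)
        (Set.insert_subset (Subgraph.mem_edgeSet.2 hx)
          (Set.singleton_subset_iff.2 (Subgraph.mem_edgeSet.2 hy)))
        (hcard.trans_eq (Set.encard_pair hne).symm)).symm
    refine ⟨_, directionMatching_isPerfectMatching f hf, Set.subset_univ _, fun u w h => ?_⟩
    have huw : s(u, w) ∈ M.edgeSet := h
    rw [hM2] at huw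
    change w = flip (f u) u
    rcases huw with huw | huw
    · rcases Sym2.eq_iff.1 huw with ⟨rfl, rfl⟩ | ⟨rfl, rfl⟩
      · simp [f]
      · simp [f, flip_of_ne hta]
    · rcases Sym2.eq_iff.1 huw with ⟨rfl, rfl⟩ | ⟨rfl, rfl⟩
      · simp [f, hxy.symm]
      · simp [f, flip_of_ne htb, hxy.symm]

theorem isBrace : IsBrace cubeGraph :=
  ⟨connected, isBipartite, Or.inr ⟨by rw [card_eq]; norm_num, matchingsExtend⟩⟩

/-- The boundary of the face of the cube on which coordinate `t` has value `β`. -/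
def faceCycle (t : Fin 3) (β : Bool) : cubeGraph.Subgraph :=
  (⊤ : cubeGraph.Subgraph).induce {x | x t = β}

theorem eq_of_agree {v x : Fin 3 → Bool} {i j t : Fin 3} (hij : i ≠ j) (hti : t ≠ i) (htj : t ≠ j)
    (h : x t = v t) : x = v ∨ x = flip i v ∨ x = flip j (flip i v) ∨ x = flip j v := by
  have hall := eq_or_eq_or_eq hij hti htj
  have hext : ∀ y : Fin 3 → Bool, x i = y i → x j = y j → x t = y t → x = y := fun y h1 h2 h3 =>
    funext fun k => by rcases hall k with rfl | rfl | rfl <;> assumption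
  by_cases h1 : x i = v i <;> by_cases h2 : x j = v j
  · exact Or.inl (hext _ h1 h2 h)
  · refine Or.inr (Or.inr (Or.inr (hext _ ?_ ?_ ?_)))
    · rw [flip_of_ne hij, h1]
    · rw [flip_same, Bool.eq_not]; exact h2
    · rw [flip_of_ne htj, h]
  · refine Or.inr (Or.inl (hext _ ?_ ?_ ?_))
    · rw [flip_same, Bool.eq_not]; exact h1
    · rw [flip_of_ne hij.symm, h2]
    · rw [flip_of_ne hti, h]
  · refine Or.inr (Or.inr (Or.inl (hext _ ?_ ?_ ?_)))
    · rw [flip_of_ne hij, flip_same, Bool.eq_not]; exact h1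
    · rw [flip_same, flip_of_ne hij.symm, Bool.eq_not]; exact h2
    · rw [flip_of_ne htj, flip_of_ne hti, h]

/-- Every 4-cycle of the cube is the boundary of one of its six faces: the four directions in which
it runs have to be `i, j, i, j`. -/
theorem exists_eq_faceCycle {C : cubeGraph.Subgraph} (hC : IsFourCycle C) :
    ∃ t β, C = faceCycle t β := by
  obtain ⟨v, w, hw, hlen, rfl⟩ := hC
  match w, hw, hlen with
  | .cons (v := a) h₁ (.cons (v := b) h₂ (.cons (v := c) h₃ (.cons h₄ .nil))), hw, _ =>
    have hnd := hw.support_nodup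
    simp only [Walk.support_cons, Walk.support_nil, List.tail_cons, List.nodup_cons, List.mem_cons,
      List.not_mem_nil, or_false, not_or] at hnd
    obtain ⟨⟨-, hac, -⟩, ⟨-, hbv⟩, -⟩ := hnd
    obtain ⟨i, rfl⟩ := adj_iff.1 h₁
    obtain ⟨j, rfl⟩ := adj_iff.1 h₂
    obtain ⟨k, rfl⟩ := adj_iff.1 h₃
    obtain ⟨l, hl⟩ := adj_iff.1 h₄
    have hij : i ≠ j := by rintro rfl; simp at hbv
    have hjk : j ≠ k := by rintro rfl; simp at hac
    have hlj : l = j := by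
      by_contra h
      have := congrFun hl j
      rw [flip_of_ne (Ne.symm h), flip_of_ne hjk, flip_same, flip_of_ne hij.symm] at this
      simp at this
    subst hlj
    have hki : k = i := by
      by_contra h
      have := congrFun hl i
      rw [flip_of_ne hij, flip_of_ne (Ne.symm h), flip_of_ne hij, flip_same] at this
      simp at this
    subst hki
    obtain ⟨t, hti, htj⟩ := exists_third k l
    have hk : flip k (flip l (flip k v)) = flip l v := by rw [flip_comm l k v, flip_flip]
    have hall := eq_or_eq_or_eq hij hti htj
    refine ⟨t, v t, Subgraph.ext ?_ ?_⟩
    · ext x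
      rw [Walk.mem_verts_toSubgraph]
      simp only [Walk.support_cons, Walk.support_nil, List.mem_cons, List.not_mem_nil, or_false,
        faceCycle, Subgraph.induce_verts, Set.mem_ofPred_eq, hk]
      constructor
      · rintro (rfl | rfl | rfl | rfl | rfl) <;> simp [flip_of_ne hti, flip_of_ne htj]
      · intro h
        rcases eq_of_agree hij hti htj h with h | h | h | h <;> simp [h]
    · ext x y
      rw [Walk.adj_toSubgraph_iff_mem_edges]
      simp only [Walk.edges_cons, Walk.edges_nil, List.mem_cons, List.not_mem_nil, or_false,
        faceCycle, Subgraph.induce_adj, Set.mem_ofPred_eq, Subgraph.top_adj, hk]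
      constructor
      · have hmem : ∀ {p q : Fin 3 → Bool}, cubeGraph.Adj p q → p t = v t → q t = v t →
            s(x, y) = s(p, q) → x t = v t ∧ y t = v t ∧ cubeGraph.Adj x y := by
          intro p q hpq hp hq h
          rcases Sym2.eq_iff.1 h with ⟨rfl, rfl⟩ | ⟨rfl, rfl⟩
          · exact ⟨hp, hq, hpq⟩
          · exact ⟨hq, hp, hpq.symm⟩
        rintro (h | h | h | h)
        · exact hmem h₁ rfl (by rw [flip_of_ne hti]) h
        · exact hmem h₂ (by rw [flip_of_ne hti]) (by rw [flip_of_ne htj, flip_of_ne hti]) h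
        · exact hmem (hk ▸ h₃) (by rw [flip_of_ne htj, flip_of_ne hti]) (by rw [flip_of_ne htj]) h
        · exact hmem (hk ▸ h₄) (by rw [flip_of_ne htj]) rfl h
      · rintro ⟨hx, hy, hxy⟩
        obtain ⟨m, rfl⟩ := adj_iff.1 hxy
        have hm : m = k ∨ m = l := by
          rcases hall m with h | h | rfl
          · exact Or.inl h
          · exact Or.inr h
          · rw [flip_same, hx] at hy; simp at hy
        rcases eq_of_agree hij hti htj hx with rfl | rfl | rfl | rfl <;>
          rcases hm with rfl | rfl <;>
          simp [flip_comm, hk]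

theorem encard_facialFourCycles_le (D : PlaneDrawing cubeGraph) :
    D.facialFourCycles.encard ≤ 6 := by
  have hsub : D.facialFourCycles ⊆ Set.range fun p : Fin 3 × Bool => faceCycle p.1 p.2 := by
    rintro C ⟨hC, -⟩
    obtain ⟨t, β, rfl⟩ := exists_eq_faceCycle hC
    exact ⟨(t, β), rfl⟩
  refine (Set.encard_le_encard hsub).trans ?_
  rw [← Set.image_univ]
  refine (Set.encard_image_le _ _).trans ?_
  simp [Set.encard_univ]

/-- Half the side of the square that carries the layer of the cube with last coordinate `b`. -/
def halfSide (b : Bool) : ℝ := if b then 3 else 1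

/-- The sign of the coordinates of a vertex. -/
def sign (b : Bool) : ℝ := if b then 1 else -1

/-- The vertices of two concentric squares. -/
def point (x : Fin 3 → Bool) : ℂ := ⟨halfSide (x 2) * sign (x 0), halfSide (x 2) * sign (x 1)⟩

theorem halfSide_mul_sign_inj {b b' c c' : Bool}
    (h : halfSide b * sign c = halfSide b' * sign c') : b = b' ∧ c = c' := by
  revert h
  cases b <;> cases b' <;> cases c <;> cases c' <;> norm_num [halfSide, sign]

theorem halfSide_pos (b : Bool) : 0 < halfSide b := by cases b <;> norm_num [halfSide]

theorem abs_sign (b : Bool) : |sign b| = 1 := by cases b <;> norm_num [sign]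

theorem abs_halfSide_mul_sign (b c : Bool) : |halfSide b * sign c| = halfSide b := by
  rw [abs_mul, abs_sign, mul_one, abs_of_pos (halfSide_pos b)]

theorem point_injective : Function.Injective point := by
  intro x y h
  have h1 := halfSide_mul_sign_inj (congrArg Complex.re h)
  have h2 := halfSide_mul_sign_inj (congrArg Complex.im h)
  funext i
  fin_cases i
  · exact h1.2
  · exact h2.2
  · exact h1.1

/-- The straight segment that represents an edge. -/
def arc (e : Sym2 (Fin 3 → Bool)) : Set ℂ := convexHull ℝ (point '' {x | x ∈ e})

theorem arc_mk (x y : Fin 3 → Bool) : arc s(x, y) = segment ℝ (point x) (point y) := by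
  rw [arc, ← convexHull_pair, ← Set.image_pair]
  congr 2
  ext z
  simp

theorem isArc_segment {a b : ℂ} (h : a ≠ b) : IsArc (segment ℝ a b) a b := by
  refine ⟨⟨⟨fun t => AffineMap.lineMap a b (t : ℝ), ?_⟩, by simp, by simp⟩, ?_, ?_⟩
  · exact AffineMap.lineMap_continuous.comp continuous_subtype_val
  · intro s t hst
    exact Subtype.ext (AffineMap.lineMap_injective ℝ h hst)
  · rw [segment_eq_image_lineMap]
    ext z
    simp

/-- The points of an edge in one of the two directions of the sides of the squares, or
in the diagonal direction. -/
theorem mem_arc_flip {x : Fin 3 → Bool} {i : Fin 3} {z : ℂ} (h : z ∈ arc s(x, flip i x)) :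
    (i = 0 ∧ |z.re| ≤ halfSide (x 2) ∧ z.im = halfSide (x 2) * sign (x 1)) ∨
    (i = 1 ∧ |z.im| ≤ halfSide (x 2) ∧ z.re = halfSide (x 2) * sign (x 0)) ∨
    (i = 2 ∧ ∃ r : ℝ, 0 < r ∧ z.re = r * sign (x 0) ∧ z.im = r * sign (x 1)) := by
  rw [arc_mk] at h
  obtain ⟨a, b, ha, hb, hab, rfl⟩ := h
  have hs : ∀ β, sign (!β) = -sign β := by intro β; cases β <;> simp [sign]
  have habs : ∀ β γ, |a * (halfSide β * sign γ) + b * (halfSide β * -sign γ)| ≤ halfSide β := by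
    intro β γ
    have h1 := halfSide_pos β
    have : a * (halfSide β * sign γ) + b * (halfSide β * -sign γ) =
      (a - b) * (halfSide β * sign γ) := by ring
    rw [this, abs_mul, abs_halfSide_mul_sign]
    have : |a - b| ≤ 1 := abs_le.2 ⟨by linarith, by linarith⟩
    nlinarith
  obtain rfl | rfl | rfl : i = 0 ∨ i = 1 ∨ i = 2 := by decide +revert
  · left
    simp only [point, flip_same, flip_of_ne (show (1 : Fin 3) ≠ 0 by decide),
      flip_of_ne (show (2 : Fin 3) ≠ 0 by decide), hs, Complex.add_re, Complex.real_smul,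
      Complex.re_ofReal_mul, Complex.add_im, Complex.im_ofReal_mul]
    exact ⟨trivial, habs _ _, by rw [← add_mul, hab, one_mul]⟩
  · right; left
    simp only [point, flip_same, flip_of_ne (show (0 : Fin 3) ≠ 1 by decide),
      flip_of_ne (show (2 : Fin 3) ≠ 1 by decide), hs, Complex.add_re, Complex.real_smul,
      Complex.re_ofReal_mul, Complex.add_im, Complex.im_ofReal_mul]
    exact ⟨trivial, habs _ _, by rw [← add_mul, hab, one_mul]⟩
  · right; right
    refine ⟨rfl, a * halfSide (x 2) + b * halfSide (!x 2), ?_, ?_, ?_⟩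
    · rcases ha.eq_or_lt with rfl | ha'
      · have : b = 1 := by linarith
        subst this
        simpa using halfSide_pos _
      · exact add_pos_of_pos_of_nonneg (mul_pos ha' (halfSide_pos _))
          (mul_nonneg hb (halfSide_pos _).le)
    all_goals
      simp only [point, flip_same, flip_of_ne (show (0 : Fin 3) ≠ 2 by decide),
        flip_of_ne (show (1 : Fin 3) ≠ 2 by decide), Complex.add_re, Complex.real_smul,
        Complex.re_ofReal_mul, Complex.add_im, Complex.im_ofReal_mul]
      ring

theorem mem_range_point {z : ℂ} {b c d : Bool} (h1 : z.re = halfSide b * sign c)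
    (h2 : z.im = halfSide b * sign d) : z ∈ Set.range point :=
  ⟨![c, d, b], Complex.ext h1.symm h2.symm⟩

theorem eq_or_eq_flip {x y : Fin 3 → Bool} {i : Fin 3} (h : ∀ j, j ≠ i → y j = x j) :
    y = x ∨ y = flip i x := by
  by_cases hi : y i = x i
  · refine Or.inl (funext fun j => ?_)
    by_cases hj : j = i
    · rw [hj, hi]
    · exact h j hj
  · refine Or.inr (funext fun j => ?_)
    by_cases hj : j = i
    · subst hj; rw [flip_same, Bool.eq_not]; exact hi
    · rw [flip_of_ne hj, h j hj]

theorem edge_eq_of_agree {x y : Fin 3 → Bool} {i : Fin 3} (h : ∀ j, j ≠ i → y j = x j) :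
    s(x, flip i x) = s(y, flip i y) := by
  rcases eq_or_eq_flip h with rfl | rfl
  · rfl
  · rw [flip_flip, Sym2.eq_swap]

theorem mul_sign_inj {r r' : ℝ} {c c' : Bool} (hr : 0 < r) (hr' : 0 < r')
    (h : r * sign c = r' * sign c') : r = r' ∧ c = c' := by
  have h1 : r = r' := by
    have := congrArg abs h
    rwa [abs_mul, abs_mul, abs_sign, abs_sign, mul_one, mul_one, abs_of_pos hr, abs_of_pos hr']
      at this
  subst h1
  refine ⟨rfl, ?_⟩
  have := mul_left_cancel₀ hr.ne' h
  revert this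
  cases c <;> cases c' <;> norm_num [sign]

theorem halfSide_inj {b b' : Bool} (h : halfSide b = halfSide b') : b = b' := by
  revert h
  cases b <;> cases b' <;> norm_num [halfSide]

theorem mem_range_point_of_mem {x y : Fin 3 → Bool} {i j : Fin 3} {z : ℂ}
    (hne : s(x, flip i x) ≠ s(y, flip j y)) (hx : z ∈ arc s(x, flip i x))
    (hy : z ∈ arc s(y, flip j y)) : z ∈ Set.range point := by
  rcases mem_arc_flip hx with ⟨rfl, h1, h2⟩ | ⟨rfl, h1, h2⟩ | ⟨rfl, r, hr, h1, h2⟩ <;>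
  rcases mem_arc_flip hy with ⟨rfl, h3, h4⟩ | ⟨rfl, h3, h4⟩ | ⟨rfl, r', hr', h3, h4⟩
  · obtain ⟨h5, h6⟩ := halfSide_mul_sign_inj (h2.symm.trans h4)
    refine absurd (edge_eq_of_agree fun j hj => ?_) hne
    fin_cases j
    · exact absurd rfl hj
    · exact h6.symm
    · exact h5.symm
  · rw [h4, abs_halfSide_mul_sign] at h1
    rw [h2, abs_halfSide_mul_sign] at h3
    have := halfSide_inj (le_antisymm h1 h3)
    exact mem_range_point h4 (this ▸ h2)
  · have h5 := mul_sign_inj hr' (halfSide_pos _) (h4.symm.trans h2)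
    exact mem_range_point (h5.1 ▸ h3) h2
  · rw [h4, abs_halfSide_mul_sign] at h1
    rw [h2, abs_halfSide_mul_sign] at h3
    have := halfSide_inj (le_antisymm h1 h3)
    exact mem_range_point h2 (this ▸ h4)
  · obtain ⟨h5, h6⟩ := halfSide_mul_sign_inj (h2.symm.trans h4)
    refine absurd (edge_eq_of_agree fun j hj => ?_) hne
    fin_cases j
    · exact h6.symm
    · exact absurd rfl hj
    · exact h5.symm
  · have h5 := mul_sign_inj hr' (halfSide_pos _) (h3.symm.trans h2)
    exact mem_range_point h2 (h5.1 ▸ h4)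
  · have h5 := mul_sign_inj hr (halfSide_pos _) (h2.symm.trans h4)
    exact mem_range_point (h5.1 ▸ h1) h4
  · have h5 := mul_sign_inj hr (halfSide_pos _) (h1.symm.trans h4)
    exact mem_range_point h4 (h5.1 ▸ h2)
  · obtain ⟨-, h5⟩ := mul_sign_inj hr hr' (h1.symm.trans h3)
    obtain ⟨-, h6⟩ := mul_sign_inj hr hr' (h2.symm.trans h4)
    refine absurd (edge_eq_of_agree fun j hj => ?_) hne
    fin_cases j
    · exact h5.symm
    · exact h6.symm
    · exact absurd rfl hj

theorem mem_of_point_mem_arc {x w : Fin 3 → Bool} {i : Fin 3}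
    (h : point w ∈ arc s(x, flip i x)) : w ∈ s(x, flip i x) := by
  refine Sym2.mem_iff.2 (eq_or_eq_flip fun j hj => ?_)
  rcases mem_arc_flip h with ⟨rfl, h1, h2⟩ | ⟨rfl, h1, h2⟩ | ⟨rfl, r, hr, h1, h2⟩
  · obtain ⟨h5, h6⟩ := halfSide_mul_sign_inj h2
    fin_cases j
    · exact absurd rfl hj
    · exact h6
    · exact h5
  · obtain ⟨h5, h6⟩ := halfSide_mul_sign_inj h2
    fin_cases j
    · exact h6
    · exact absurd rfl hj
    · exact h5
  · obtain ⟨-, h5⟩ := mul_sign_inj (halfSide_pos _) hr h1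
    obtain ⟨-, h6⟩ := mul_sign_inj (halfSide_pos _) hr h2
    fin_cases j
    · exact h5
    · exact h6
    · exact absurd rfl hj

theorem exists_eq_flip {e : Sym2 (Fin 3 → Bool)} (he : e ∈ cubeGraph.edgeSet) :
    ∃ x i, e = s(x, flip i x) := by
  induction e with
  | h x y =>
    obtain ⟨i, rfl⟩ := adj_iff.1 (cubeGraph.mem_edgeSet.1 he)
    exact ⟨x, i, rfl⟩

/-- The drawing of the cube as two concentric squares with corresponding corners joined. -/
def drawing : PlaneDrawing cubeGraph where
  point := point
  arc := arc
  point_injective := point_injective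
  isArc x y h := by
    rw [arc_mk]
    exact isArc_segment (point_injective.ne h.ne)
  mem_of_point_mem e he w hw := by
    obtain ⟨x, i, rfl⟩ := exists_eq_flip he
    exact mem_of_point_mem_arc hw
  inter_subset e he e' he' hne z hz := by
    obtain ⟨x, i, rfl⟩ := exists_eq_flip he
    obtain ⟨y, j, rfl⟩ := exists_eq_flip he'
    exact mem_range_point_of_mem hne hz.1 hz.2

end Cube

theorem lemma3p1 :
    (∀ (V : Type*) [Finite V] (G : SimpleGraph V), IsBrace G → IsEmpty (G ≃g cycleGraph 4) →
      ∀ D : PlaneDrawing G, 6 ≤ D.facialFourCycles.encard) ∧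
    (IsBrace cubeGraph ∧ IsEmpty (cubeGraph ≃g cycleGraph 4) ∧ Nonempty (PlaneDrawing cubeGraph) ∧
      ∀ D : PlaneDrawing cubeGraph, D.facialFourCycles.encard = 6) := by
  refine ⟨fun V _ G hG hC D => ?_, Cube.isBrace, Cube.isEmpty_iso_cycleGraph, ⟨Cube.drawing⟩,
    fun D => ?_⟩
  · obtain ⟨hcard, hext⟩ := hG.extendable.resolve_left (not_nonempty_iff.2 hC)
    exact six_le_encard_facialFourCycles hG.connected hG.bipartite hcard hext D
  · exact le_antisymm (Cube.encard_facialFourCycles_le D)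
      (six_le_encard_facialFourCycles Cube.connected Cube.isBipartite
        (by rw [Cube.card_eq]; norm_num) Cube.matchingsExtend D)
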